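/- Let $n\ge 1$, let $U\subset\mathbb R^n$ be open and identify $T^*U=U\times\mathbb R^n\ni(x,\xi)$, with $|\cdot|$ the Euclidean norm. Fix a smooth function $\chi$ on $T^*U$ with $\chi=0$ for $|\xi|\le 1/2$ and $\chi=1$ for $|\xi|\ge1$. *Symbols.* For $r\in\mathbb R$, a symbol of order $r$ on $U$ is a smooth $\sigma:T^*U\to\mathbb C$ such that for every compact $K\subset U$ and all multi-indices $\mu,\gamma$ there is $C$ with $|\partial_x^\mu\partial_\xi^\gamma\sigma(x,\xi)|\le C(1+|\xi|)^{r-|\gamma|}$ for $x\in K$, $\xi\in\mathbb R^n$. For $m\in\mathbb C$, $CS^m(U)$ is the set of symbols $\sigma$ of order $\mathrm{Re}\,m$ for which there are smooth functions $\sigma_{m-i}$ on $U\times(\mathbb R^n\setminus\{0\})$, $i\ge0$, with $\sigma_{m-i}(x,t\xi)=t^{m-i}\sigma_{m-i}(x,\xi)$ for $t>0$, such that $\sigma-\sum_{i=0}^N\chi\,\sigma_{m-i}$ is a symbol of order $\mathrm{Re}\,m-N-1$ for every $N\ge 0$. $CS^m_{com}(U)$ is the set of those $\sigma\in CS^m(U)$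 that vanish for $x$ outside a compact subset of $U$. If $\sigma=\sum_l\sigma^l$ is a finite sum with $\sigma^l\in CS^{m_l}(U)$, its homogeneous component of degree $s\in\mathbb C$ is $\sigma_s=\sum_{l,i:\,m_l-i=s}\sigma^l_{m_l-i}$. *Forms.* $\Omega^kCS^m_{com}(U)$ is the set of smooth complex $k$-forms $\alpha=\sum_{|I|+|J|=k}\alpha_{I,J}\,dx_I\wedge d\xi_J$ on $T^*U$ with $\alpha_{I,J}\in CS^{m-|J|}_{com}(U)$ for all $I,J\subset\{1,\dots,n\}$; $\Omega^kCS_{com}(U)$ is the linear span of these sets over $m\in\mathbb C$, and $\Omega^kCS^{\notin\mathbb Z}_{com}(U)=\bigcup_{m\in\mathbb C\setminus\mathbb Z}\Omega^kCS^m_{com}(U)$. *Cut-off integrals.* If $f(R)=c+\sum_{\lambda\in S}a_\lambda R^\lambda+b\log R+o(1)$ as $R\to\infty$, with $S\subset\mathbb C\setminus\{0\}$ finite and $a_\lambda,b,c\in\mathbb C$, then $c=:\mathrm{fp}_{R\to\infty}f(R)$ is uniquely determined. For a $2n$-form $\alpha=\sigma\,dx_1\wedge\cdots\wedge dx_n\wedge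 d\xi_1\wedge\cdots\wedge d\xi_n$ put $$-\!\!\!\!\!\!\int_{T^*U}\alpha=\int_U\Big(\mathrm{fp}_{R\to\infty}\int_{|\xi|<R}\sigma(x,\xi)\,d\xi\Big)dx ,$$ which is said to exist if $\sigma(x,\cdot)$ is integrable over every ball and the finite part exists for every $x\in U$, and the finite part is integrable in $x\in U$. **Theorem.** Let $\beta=\sum_{|I|+|J|=2n-1}\beta_{I,J}\,dx_I\wedge d\xi_J\in\Omega^{2n-1}CS_{com}(U)$. Then the cut-off integral of $d\beta$ exists, the homogeneous components $\beta_{I,J,-n+1}$ of degree $-n+1$ of the $\beta_{I,J}$ give integrable forms on the unit cosphere bundle $S^*U=\{(x,\xi)\in T^*U:|\xi|=1\}$, and $$-\!\!\!\!\!\!\int_{T^*U}d\beta=\sum_{|I|+|J|=2n-1}\int_{S^*U}\beta_{I,J,-n+1}(x,\xi)\,dx_I\wedge d\xi_J .$$ Here $T^*U$ is oriented by $dx_1\wedge\cdots\wedge dx_n\wedge d\xi_1\wedge\cdots\wedge d\xi_n$ and $S^*U$ is oriented as the boundary of the unit ball bundle $\{|\xi|\le1\}$ (outward normal first). Moreover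 Stokes' formula $$-\!\!\!\!\!\!\int_{T^*U}d\beta=0$$ holds for every $\beta\in\Omega^{2n-1}CS^{\notin\mathbb Z}_{com}(U)$. -/

import Mathlib

open MeasureTheory Filter Topology Set
open scoped ContDiff

namespace CutoffStokes

noncomputable section

/-! ### Finite parts -/

/-- `f R` has, as `R → ∞`, an expansion `c + ∑ a_λ R ^ λ + b log R + o(1)` with finitely many
nonzero complex exponents `λ`. The number `c` is the finite part of `f` at infinity. -/
def HasFinitePart (f : ℝ → ℂ) (c : ℂ) : Prop :=
  ∃ (S : Finset ℂ) (a : ℂ → ℂ) (b : ℂ), (0 : ℂ) ∉ S ∧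
    Tendsto (fun R : ℝ => f R - ∑ l ∈ S, a l * (R : ℂ) ^ l - b * (Real.log R : ℂ)) atTop (𝓝 c)

theorem exp_sum_limit (S : Finset ℂ) (hS : (0 : ℂ) ∉ S) :
    ∀ (a : ℂ → ℂ) (b d c : ℂ),
      Tendsto (fun t : ℝ => ∑ l ∈ S, a l * Complex.exp (l * t) + b * t + d) atTop (𝓝 c) →
      b = 0 ∧ c = d := by
  classical
  induction S using Finset.induction_on with
  | empty =>
    intro a b d c h
    simp only [Finset.sum_empty, zero_add] at h
    have h1 : Tendsto (fun t : ℝ => b * ((t + 1 : ℝ) : ℂ) + d) atTop (𝓝 c) :=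
      h.comp (tendsto_atTop_add_const_right atTop (1 : ℝ) tendsto_id)
    have h2 := h1.sub h
    have h3 : Tendsto (fun _ : ℝ => b) atTop (𝓝 (c - c)) := by
      refine h2.congr fun t => ?_
      push_cast
      ring
    have hb : b = 0 := by simpa using tendsto_nhds_unique tendsto_const_nhds h3
    subst hb
    refine ⟨rfl, ?_⟩
    simp only [zero_mul, zero_add] at h
    exact (tendsto_nhds_unique tendsto_const_nhds h).symm
  | insert l₀ S hl ih =>
    intro a b d c h
    have hl₀ : l₀ ≠ 0 := fun h0 => hS (by simp [h0])
    have hS' : (0 : ℂ) ∉ S := fun h0 => hS (by simp [h0])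
    obtain ⟨s, hs⟩ : ∃ s : ℝ, Complex.exp (l₀ * s) ≠ 1 := by
      by_contra! hall
      have hd : HasDerivAt (fun s : ℝ => Complex.exp (l₀ * s)) (l₀ * 1) 0 := by
        have := ((Complex.ofRealCLM.hasDerivAt (x := (0 : ℝ))).const_mul l₀).cexp
        simpa using this
      have hc : (fun s : ℝ => Complex.exp (l₀ * s)) = fun _ => (1 : ℂ) := funext hall
      rw [hc] at hd
      exact hl₀ (by simpa using (hd.unique (hasDerivAt_const _ _)))
    have h1 := h.comp (tendsto_atTop_add_const_right atTop s tendsto_id)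
    have h2 := h1.sub (h.const_mul (Complex.exp (l₀ * s)))
    set E := Complex.exp (l₀ * s) with hE
    have h3 : Tendsto (fun t : ℝ =>
        ∑ l ∈ S, (a l * (Complex.exp (l * s) - E)) * Complex.exp (l * t)
          + (b * (1 - E)) * t + (b * s + d * (1 - E))) atTop (𝓝 (c - E * c)) := by
      refine h2.congr fun t => ?_
      simp only [Function.comp, id, Finset.sum_insert hl]
      push_cast
      have e1 : ∀ l : ℂ, Complex.exp (l * (t + s)) = Complex.exp (l * s) * Complex.exp (l * t) := by
        intro l
        rw [← Complex.exp_add]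
        ring_nf
      have e2 : ∑ l ∈ S, (a l * (Complex.exp (l * s) - E)) * Complex.exp (l * t)
          = ∑ l ∈ S, a l * Complex.exp (l * (t + s)) - E * ∑ l ∈ S, a l * Complex.exp (l * t) := by
        rw [Finset.mul_sum, ← Finset.sum_sub_distrib]
        refine Finset.sum_congr rfl fun l _ => ?_
        rw [e1]
        ring
      rw [e2, e1 l₀, ← hE]
      ring
    obtain ⟨hb, hc⟩ := ih hS' _ _ _ _ h3
    have hE1 : (1 - E) ≠ 0 := sub_ne_zero.mpr (Ne.symm hs)
    have hb0 : b = 0 := by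
      rcases mul_eq_zero.mp hb with h | h
      · exact h
      · exact absurd h hE1
    refine ⟨hb0, ?_⟩
    subst hb0
    apply mul_right_cancel₀ hE1
    linear_combination hc

/-- The finite part is unique. -/
theorem HasFinitePart.unique {f : ℝ → ℂ} {c c' : ℂ}
    (h : HasFinitePart f c) (h' : HasFinitePart f c') : c = c' := by
  classical
  obtain ⟨S, a, b, hS, hT⟩ := h
  obtain ⟨S', a', b', hS', hT'⟩ := h'
  have h1 := (hT.sub hT').comp Real.tendsto_exp_atTop
  have h2 : Tendsto (fun t : ℝ => ∑ l ∈ S ∪ S',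
      ((if l ∈ S' then a' l else 0) - (if l ∈ S then a l else 0)) * Complex.exp (l * t)
        + (b' - b) * t + 0) atTop (𝓝 (c - c')) := by
    refine h1.congr fun t => ?_
    have e : ∀ l : ℂ, ((Real.exp t : ℝ) : ℂ) ^ l = Complex.exp (l * t) := by
      intro l
      rw [Complex.cpow_def_of_ne_zero (by exact_mod_cast (Real.exp_pos t).ne'),
        ← Complex.ofReal_log (Real.exp_pos t).le, Real.log_exp, mul_comm]
    have e1 : ∑ l ∈ S ∪ S', (if l ∈ S then a l else 0) * Complex.exp (l * t)
        = ∑ l ∈ S, a l * Complex.exp (l * t) := by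
      simp only [ite_mul, zero_mul, ← Finset.sum_filter]
      congr 1
      ext l
      simp only [Finset.mem_filter, Finset.mem_union]
      tauto
    have e2 : ∑ l ∈ S ∪ S', (if l ∈ S' then a' l else 0) * Complex.exp (l * t)
        = ∑ l ∈ S', a' l * Complex.exp (l * t) := by
      simp only [ite_mul, zero_mul, ← Finset.sum_filter]
      congr 1
      ext l
      simp only [Finset.mem_filter, Finset.mem_union]
      tauto
    simp only [Function.comp, e, Real.log_exp, sub_mul, Finset.sum_sub_distrib, e1, e2]
    ring
  have hU : (0 : ℂ) ∉ S ∪ S' := by simp [hS, hS']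
  exact sub_eq_zero.mp (exp_sum_limit _ hU _ _ _ _ h2).2

open Classical in
/-- The finite part `fp_{R → ∞} f R` (equal to `0` when there is none). -/
def finitePart (f : ℝ → ℂ) : ℂ := if h : ∃ c, HasFinitePart f c then h.choose else 0

theorem HasFinitePart.finitePart_eq {f : ℝ → ℂ} {c : ℂ} (h : HasFinitePart f c) :
    finitePart f = c := by
  have h' : ∃ c, HasFinitePart f c := ⟨c, h⟩
  rw [finitePart, dif_pos h']
  exact h'.choose_spec.unique h

/-! ### Classical symbols on `T*U = U × ℝⁿ` -/

/-- Euclidean space `ℝⁿ`. -/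
abbrev Eu (n : ℕ) : Type := EuclideanSpace ℝ (Fin n)

/-- The space `T*ℝⁿ = ℝⁿ × ℝⁿ` of pairs `(x, ξ)`. -/
abbrev Ph (n : ℕ) : Type := Eu n × Eu n

/-- The coordinate vectors `∂/∂x_i` (`Sum.inl i`) and `∂/∂ξ_j` (`Sum.inr j`). -/
def coordVec (n : ℕ) : Fin n ⊕ Fin n → Ph n :=
  Sum.elim (fun i => (EuclideanSpace.single i 1, 0)) (fun j => (0, EuclideanSpace.single j 1))

/-- Scalar symbols of real order `m` on `U`: smooth functions on `T*U` such that for each compact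
`K ⊆ U` and each iterated partial derivative `∂_x^μ ∂_ξ^γ` (given by a list `s` of coordinates,
`|γ|` of which are `ξ`-coordinates) one has
`|∂_x^μ ∂_ξ^γ σ(x, ξ)| ≤ C (1 + |ξ|)^(m - |γ|)` for `x ∈ K`.
Only the values of `σ` on `U × ℝⁿ` matter. -/
def IsSymbol {n : ℕ} (U : Set (Eu n)) (m : ℝ) (σ : Ph n → ℂ) : Prop :=
  ContDiffOn ℝ ∞ σ (U ×ˢ univ) ∧
  ∀ K : Set (Eu n), IsCompact K → K ⊆ U →
    ∀ (r : ℕ) (s : Fin r → Fin n ⊕ Fin n), ∃ C : ℝ, ∀ x ∈ K, ∀ ξ : Eu n,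
      ‖iteratedFDeriv ℝ r σ (x, ξ) (fun i => coordVec n (s i))‖
        ≤ C * (1 + ‖ξ‖) ^ (m - ((Finset.univ.filter fun i => (s i).isRight = true).card : ℝ))

/-- `χ` is smooth on `T*U`, vanishes for `|ξ| ≤ 1/2` and equals `1` for `|ξ| ≥ 1`. -/
def IsExcision {n : ℕ} (U : Set (Eu n)) (χ : Ph n → ℝ) : Prop :=
  ContDiffOn ℝ ∞ χ (U ×ˢ univ) ∧
  (∀ x ∈ U, ∀ ξ : Eu n, ‖ξ‖ ≤ 1 / 2 → χ (x, ξ) = 0) ∧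
  (∀ x ∈ U, ∀ ξ : Eu n, 1 ≤ ‖ξ‖ → χ (x, ξ) = 1)

/-- `τ` is smooth on `T*U` minus the zero section and positively homogeneous of degree `s`
in `ξ`. -/
def IsPosHomogeneous {n : ℕ} (U : Set (Eu n)) (s : ℂ) (τ : Ph n → ℂ) : Prop :=
  ContDiffOn ℝ ∞ τ (U ×ˢ {0}ᶜ) ∧
  ∀ x ∈ U, ∀ ξ : Eu n, ξ ≠ 0 → ∀ t : ℝ, 0 < t → τ (x, t • ξ) = (t : ℂ) ^ s * τ (x, ξ)

/-- `σ` is a classical symbol of complex order `m` with `σ ∼ ∑ i, χ τ_i`, where `τ_i = σ_{m-i}` is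
positively homogeneous of degree `m - i`. -/
def HasClassicalExpansion {n : ℕ} (U : Set (Eu n)) (χ : Ph n → ℝ) (m : ℂ)
    (σ : Ph n → ℂ) (τ : ℕ → Ph n → ℂ) : Prop :=
  IsSymbol U m.re σ ∧
  (∀ i : ℕ, IsPosHomogeneous U (m - i) (τ i)) ∧
  ∀ N : ℕ, IsSymbol U (m.re - N - 1)
    (fun p => σ p - ∑ i ∈ Finset.range (N + 1), (χ p : ℂ) * τ i p)

/-- The class `CS^m_com(U)` of classical symbols of order `m` with compact support in `U`
(that is, vanishing for `x` outside a compact subset of `U`). -/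
def IsClassicalCom {n : ℕ} (U : Set (Eu n)) (χ : Ph n → ℝ) (m : ℂ) (σ : Ph n → ℂ) : Prop :=
  (∃ τ : ℕ → Ph n → ℂ, HasClassicalExpansion U χ m σ τ) ∧
  ∃ K : Set (Eu n), IsCompact K ∧ K ⊆ U ∧ ∀ x ∈ U \ K, ∀ ξ : Eu n, σ (x, ξ) = 0

/-- `τ` is the positively homogeneous component `σ_s` of degree `s` of `σ ∈ CS(U)`, where `CS(U)`
is spanned by classical symbols of all complex orders: if `σ = ∑ l, σ^l` is a finite sum of
classical symbols with `σ^l ∼ ∑ i, χ σ^l_{m_l - i}`, then `σ_s` is the sum of all the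
`σ^l_{m_l - i}` with `m_l - i = s`. -/
def IsHomogComponent {n : ℕ} (U : Set (Eu n)) (χ : Ph n → ℝ) (s : ℂ)
    (σ τ : Ph n → ℂ) : Prop :=
  ∃ (L : ℕ) (m : Fin L → ℂ) (σ' : Fin L → Ph n → ℂ) (e : Fin L → ℕ → Ph n → ℂ),
    (∀ l, HasClassicalExpansion U χ (m l) (σ' l) (e l)) ∧
    (∀ x ∈ U, ∀ ξ : Eu n, σ (x, ξ) = ∑ l, σ' l (x, ξ)) ∧
    ∀ x ∈ U, ∀ ξ : Eu n, ξ ≠ 0 →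
      τ (x, ξ) = ∑ l, ∑ᶠ (i : ℕ) (_ : m l - (i : ℂ) = s), e l i (x, ξ)

/-! ### Symbol valued forms -/

/-- Complex valued differential forms of degree `k` in the variables `(x, ξ)`. -/
abbrev Form (n k : ℕ) : Type := Ph n → Ph n [⋀^Fin k]→L[ℝ] ℂ

/-- Sets of `k` of the `2n` coordinates `x_1 < ⋯ < x_n < ξ_1 < ⋯ < ξ_n`, that is, pairs `(I, J)` of
subsets of `{1, …, n}` with `|I| + |J| = k`. -/
abbrev MultiIndex (n k : ℕ) : Type := {p : Finset (Fin n ⊕ₗ Fin n) // p.card = k}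

/-- The number `|J|` of `ξ`-coordinates in `(I, J)`. -/
def MultiIndex.cardJ {n k : ℕ} (p : MultiIndex n k) : ℕ :=
  (p.1.filter fun c => (ofLex c).isRight = true).card

/-- The multi-index containing all the coordinates. -/
def MultiIndex.full {n k : ℕ} (h : n + n = k) : MultiIndex n k := ⟨Finset.univ, by simpa using h⟩

/-- The vectors `∂/∂x_i`, `i ∈ I`, followed by the `∂/∂ξ_j`, `j ∈ J`, in increasing order. -/
def frame {n k : ℕ} (p : MultiIndex n k) : Fin k → Ph n := fun a =>
  coordVec n (ofLex (p.1.orderEmbOfFin p.2 a))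

/-- The coefficient `α_{I,J}` in `α = ∑ α_{I,J} dx_I ∧ dξ_J`. -/
def coeff {n k : ℕ} (α : Form n k) (p : MultiIndex n k) : Ph n → ℂ := fun z => α z (frame p)

/-- `α ∈ Ω^k CS^m_com(U)`: a smooth `k`-form on `T*U` whose coefficient `α_{I,J}` lies in
`CS^{m - |J|}_com(U)` for all `I, J`. -/
def IsClassicalFormCom {n k : ℕ} (U : Set (Eu n)) (χ : Ph n → ℝ) (m : ℂ) (α : Form n k) : Prop :=
  ContDiffOn ℝ ∞ α (U ×ˢ univ) ∧
  ∀ p : MultiIndex n k, IsClassicalCom U χ (m - (p.cardJ : ℂ)) (coeff α p)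

/-- `Ω^k CS_com(U)`: the space spanned by the `Ω^k CS^m_com(U)`, `m ∈ ℂ`. -/
def symbolFormsCom {n : ℕ} (U : Set (Eu n)) (χ : Ph n → ℝ) (k : ℕ) : Submodule ℂ (Form n k) :=
  Submodule.span ℂ {α | ∃ m : ℂ, IsClassicalFormCom U χ m α}

/-- `Ω^k CS^{∉ ℤ}_com(U)`: the union of the `Ω^k CS^m_com(U)` over non-integers `m ∈ ℂ`. -/
def nonIntegerFormsCom {n : ℕ} (U : Set (Eu n)) (χ : Ph n → ℝ) (k : ℕ) : Set (Form n k) :=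
  {α | ∃ m : ℂ, (∀ z : ℤ, m ≠ (z : ℂ)) ∧ IsClassicalFormCom U χ m α}

/-! ### Cut-off integrals -/

/-- The cut-off integral of `σ` over the fibre `T_x^*U`: the finite part as `R → ∞` of the integral
of `σ(x, ·)` over the ball of radius `R`. -/
def fibreCutoff {n : ℕ} (σ : Ph n → ℂ) (x : Eu n) : ℂ :=
  finitePart fun R => ∫ ξ in Metric.ball (0 : Eu n) R, σ (x, ξ)

/-- The cut-off integral of the function `σ` over `T*U` is well defined: the integral over the ball
of radius `R` in each fibre has a finite part, which is integrable in `x ∈ U`. -/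
def CutoffExists {n : ℕ} (U : Set (Eu n)) (σ : Ph n → ℂ) : Prop :=
  (∀ x ∈ U, ∀ R : ℝ, IntegrableOn (fun ξ => σ (x, ξ)) (Metric.ball (0 : Eu n) R)) ∧
  (∀ x ∈ U, ∃ c : ℂ, HasFinitePart (fun R => ∫ ξ in Metric.ball (0 : Eu n) R, σ (x, ξ)) c) ∧
  IntegrableOn (fibreCutoff σ) U

/-- The cut-off integral of the function `σ` over `T*U`. -/
def cutoffFun {n : ℕ} (U : Set (Eu n)) (σ : Ph n → ℂ) : ℂ := ∫ x in U, fibreCutoff σ x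

/-- The coefficient of `dx_1 ∧ ⋯ ∧ dx_n ∧ dξ_1 ∧ ⋯ ∧ dξ_n` in a form of degree `k`, which is `0`
unless `k = 2n`. -/
def topCoeff {n k : ℕ} (α : Form n k) : Ph n → ℂ :=
  if h : n + n = k then coeff α (MultiIndex.full h) else 0

/-- The cut-off integral over `T*U` of a form `α` on `T*U`, which is `0` unless `α` has
degree `2n`. -/
def cutoffIntegral {n k : ℕ} (U : Set (Eu n)) (α : Form n k) : ℂ := cutoffFun U (topCoeff α)

/-! ### Integration over the cosphere bundle -/

/-- The pairing `∑ u_i u'_i + ∑ η_j η'_j` of `(u, η)` and `(u', η')`. -/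
def pairing {n : ℕ} (v w : Ph n) : ℝ := inner ℝ v.1 w.1 + inner ℝ v.2 w.2

/-- The density of the pull-back of `dx_I ∧ dξ_J`, `|I| + |J| = 2n - 1`, to the unit cosphere
bundle `S*U = U × S^{n-1}` with respect to the Riemannian measure `dx dS(ξ)`. Here
`T*U` is oriented by `dx_1 ∧ ⋯ ∧ dx_n ∧ dξ_1 ∧ ⋯ ∧ dξ_n`, and `S*U` is oriented as the boundary of
the unit ball bundle (outward normal first), so that with `ν = ∑ ξ_j dξ_j` the density `h` is
determined by `ν ∧ dx_I ∧ dξ_J = h dx_1 ∧ ⋯ ∧ dx_n ∧ dξ_1 ∧ ⋯ ∧ dξ_n`; it is the determinant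
of the matrix of components of the covectors `ν`, `dx_i` (`i ∈ I`), `dξ_j` (`j ∈ J`). -/
def cosphereDensity {n k : ℕ} (hk : n + n = k + 1) (p : MultiIndex n k) (ξ : Eu n) : ℝ :=
  Matrix.det (Matrix.of fun a b : Fin (k + 1) =>
    pairing ((Fin.cons (0, ξ) (frame p) : Fin (k + 1) → Ph n) a)
      (frame (MultiIndex.full hk) b))

/-- The measure `dx dS(ξ)` on `U × S^{n-1}`. -/
def cosphereMeasure {n : ℕ} (U : Set (Eu n)) : Measure (Eu n × Metric.sphere (0 : Eu n) 1) :=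
  ((volume : Measure (Eu n)).restrict U).prod (volume : Measure (Eu n)).toSphere

/-- The integrand of `∫_{S*U} g dx_I ∧ dξ_J`. -/
def cosphereIntegrand {n k : ℕ} (hk : n + n = k + 1) (p : MultiIndex n k) (g : Ph n → ℂ) :
    Eu n × Metric.sphere (0 : Eu n) 1 → ℂ :=
  fun z => g (z.1, z.2) * (cosphereDensity hk p z.2 : ℂ)

/-- The integral `∫_{S*U} g dx_I ∧ dξ_J` over the unit cosphere bundle. -/
def cosphereIntegral {n k : ℕ} (hk : n + n = k + 1) (U : Set (Eu n)) (p : MultiIndex n k)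
    (g : Ph n → ℂ) : ℂ :=
  ∫ z, cosphereIntegrand hk p g z ∂(cosphereMeasure U)

end

end CutoffStokes

open CutoffStokes

/-!
Why the formula holds. The coefficient of `dβ` is a signed sum of partial derivatives: the `a`-th
coordinate derivative is applied to the coefficient of `β` that omits the `a`-th coordinate
(`topCoeff_extDeriv`). Each derivative is treated separately.

For a `ξ`-derivative the divergence theorem on the ball of radius `R` in a fixed fibre
(`integral_ball_fderiv`) turns the integral into `R ^ (n - 1)` times a spherical mean of the symbol.
Inserting the asymptotic expansion, the finite part of this boundary term is the spherical mean of
the component of degree `-n + 1` (`IsHomogComponent.hasFinitePart_sphere`). No logarithm and no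
further constant occurs.

For an `x`-derivative the finite part is written explicitly as a sum of three averages over the
fibre: the integral over the unit ball, multiples of the spherical means of the homogeneous terms,
and the convergent integral of the remainder outside the unit ball. Each is an average of
`x`-derivatives of functions with compact support in `x`, so by Fubini's theorem its integral over
`U` vanishes (`HasClassicalExpansion.exists_finitePart_fderiv_fst`).

On the other side, expanding the determinant defining the density on the cosphere bundle along the
row of the conormal shows that it is the same sign times the component of the conormal in the
omitted direction (`cosphereDensity_complIndex`), which is zero in the `x`-directions.

Homogeneous components are defined through a choice of expansions. The finite part formula for
spherical means, applied to a Dirac mass on the sphere, shows that the values of a symbol on a fibre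
determine its components there; in particular the components inherit compact support in `x`, which
is what makes them integrable over the cosphere bundle. For a form of non-integral order the
component of degree `-n + 1` is zero, and Stokes' formula follows.
-/

namespace CutoffStokes

/-! ### Calculus of finite parts -/

theorem HasFinitePart.congr' {f g : ℝ → ℂ} {c : ℂ} (h : HasFinitePart f c)
    (hfg : f =ᶠ[atTop] g) : HasFinitePart g c := by
  obtain ⟨S, a, b, hS, hT⟩ := h
  refine ⟨S, a, b, hS, hT.congr' ?_⟩
  filter_upwards [hfg] with R hR
  rw [hR]

theorem hasFinitePart_of_tendsto {f : ℝ → ℂ} {c : ℂ} (h : Tendsto f atTop (𝓝 c)) :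
    HasFinitePart f c :=
  ⟨∅, 0, 0, by simp, by simpa using h⟩

theorem hasFinitePart_const (c : ℂ) : HasFinitePart (fun _ => c) c :=
  hasFinitePart_of_tendsto tendsto_const_nhds

theorem HasFinitePart.add {f g : ℝ → ℂ} {c d : ℂ} (hf : HasFinitePart f c)
    (hg : HasFinitePart g d) : HasFinitePart (fun R => f R + g R) (c + d) := by
  classical
  obtain ⟨S, a, b, hS, hT⟩ := hf
  obtain ⟨S', a', b', hS', hT'⟩ := hg
  refine ⟨S ∪ S', fun l => (if l ∈ S then a l else 0) + (if l ∈ S' then a' l else 0), b + b',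
    by simp [hS, hS'], (hT.add hT').congr fun R => ?_⟩
  have e1 : ∑ l ∈ S ∪ S', (if l ∈ S then a l else 0) * (R : ℂ) ^ l = ∑ l ∈ S, a l * (R : ℂ) ^ l := by
    rw [← Finset.sum_subset (Finset.subset_union_left (s₁ := S) (s₂ := S'))
      fun l _ hl => by simp [hl]]
    exact Finset.sum_congr rfl fun l hl => by simp [hl]
  have e2 : ∑ l ∈ S ∪ S', (if l ∈ S' then a' l else 0) * (R : ℂ) ^ l
      = ∑ l ∈ S', a' l * (R : ℂ) ^ l := by
    rw [← Finset.sum_subset (Finset.subset_union_right (s₁ := S) (s₂ := S'))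
      fun l _ hl => by simp [hl]]
    exact Finset.sum_congr rfl fun l hl => by simp [hl]
  simp only [add_mul, Finset.sum_add_distrib, e1, e2]
  ring

theorem HasFinitePart.const_mul {f : ℝ → ℂ} {c : ℂ} (k : ℂ) (hf : HasFinitePart f c) :
    HasFinitePart (fun R => k * f R) (k * c) := by
  obtain ⟨S, a, b, hS, hT⟩ := hf
  refine ⟨S, fun l => k * a l, k * b, hS, (hT.const_mul k).congr fun R => ?_⟩
  simp only [mul_sub, Finset.mul_sum, mul_assoc]

theorem HasFinitePart.sum {ι : Type*} (s : Finset ι) {f : ι → ℝ → ℂ} {c : ι → ℂ}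
    (h : ∀ i ∈ s, HasFinitePart (f i) (c i)) :
    HasFinitePart (fun R => ∑ i ∈ s, f i R) (∑ i ∈ s, c i) := by
  classical
  induction s using Finset.induction_on with
  | empty => simpa using hasFinitePart_const 0
  | insert i s hi ih =>
    simp only [Finset.sum_insert hi]
    exact (h i (by simp)).add (ih fun j hj => h j (by simp [hj]))

theorem hasFinitePart_cpow {z : ℂ} (hz : z ≠ 0) : HasFinitePart (fun R => (R : ℂ) ^ z) 0 :=
  ⟨{z}, 1, 0, by simpa using hz.symm, by simp⟩

theorem hasFinitePart_log : HasFinitePart (fun R => (Real.log R : ℂ)) 0 :=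
  ⟨∅, 0, 1, by simp, by simp⟩

/-- For `z = 0` the integral is a logarithm, whose finite part `0` agrees with the
convention `-1 / 0 = 0`. -/
theorem hasFinitePart_integral_cpow (z : ℂ) :
    HasFinitePart (fun R => ∫ r in Ioo 1 R, (r : ℂ) ^ (z - 1)) (-1 / z) := by
  by_cases hz : z = 0
  · subst hz
    simp only [div_zero]
    refine hasFinitePart_log.congr' ?_
    filter_upwards [eventually_gt_atTop 1] with R hR
    rw [← integral_Ioc_eq_integral_Ioo, ← intervalIntegral.integral_of_le hR.le]
    have : ∀ r : ℝ, (r : ℂ) ^ (0 - 1 : ℂ) = ((r⁻¹ : ℝ) : ℂ) := fun r => by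
      rw [zero_sub, Complex.cpow_neg_one]; push_cast; rfl
    simp only [this]
    rw [intervalIntegral.integral_ofReal, integral_inv_of_pos one_pos (by linarith), div_one]
  · have h := ((hasFinitePart_cpow hz).const_mul (1 / z)).add (hasFinitePart_const (-1 / z))
    rw [mul_zero, zero_add] at h
    refine h.congr' ?_
    filter_upwards [eventually_gt_atTop 1] with R hR
    rw [← integral_Ioc_eq_integral_Ioo, ← intervalIntegral.integral_of_le hR.le,
      integral_cpow (Or.inr ⟨by simpa [sub_eq_iff_eq_add] using hz, fun h0 => by
        rw [uIcc_of_le hR.le] at h0; linarith [h0.1]⟩)]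
    simp
    ring

/-! ### Polar coordinates and the divergence theorem on balls -/

theorem integrable_polar {n : ℕ} {f : Eu n → ℂ} (hf : Integrable f) :
    Integrable (fun z : Metric.sphere (0 : Eu n) 1 × Ioi (0 : ℝ) => f (z.2.1 • z.1.1))
      ((volume : Measure (Eu n)).toSphere.prod (Measure.volumeIoiPow (n - 1))) := by
  have h := (volume : Measure (Eu n)).measurePreserving_homeomorphUnitSphereProd
  rw [finrank_euclideanSpace_fin] at h
  rw [← h.integrable_comp_emb (Homeomorph.measurableEmbedding _)]
  have h1 : Integrable (fun x : ({0}ᶜ : Set (Eu n)) => f x)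
      (Measure.comap Subtype.val (volume : Measure (Eu n))) := by
    have := (integrableOn_iff_comap_subtypeVal (μ := (volume : Measure (Eu n))) (f := f)
      (measurableSet_singleton (0 : Eu n)).compl).1 hf.integrableOn
    exact this
  refine h1.congr (Eventually.of_forall fun x => ?_)
  have : x = (homeomorphUnitSphereProd (Eu n)).symm (homeomorphUnitSphereProd (Eu n) x) := by simp
  conv_lhs => rw [this]
  rfl

theorem integral_polar {n : ℕ} (hn : 0 < n) {f : Eu n → ℂ} (hf : Integrable f) :
    ∫ ξ, f ξ = ∫ r in Ioi (0 : ℝ), (r : ℂ) ^ (n - 1) *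
      ∫ θ : Metric.sphere (0 : Eu n) 1, f (r • θ.1) ∂(volume : Measure (Eu n)).toSphere := by
  have : Nonempty (Fin n) := ⟨⟨0, hn⟩⟩
  have h := (volume : Measure (Eu n)).measurePreserving_homeomorphUnitSphereProd
  rw [finrank_euclideanSpace_fin] at h
  calc
    ∫ ξ, f ξ = ∫ x : ({0}ᶜ : Set (Eu n)), f x
        ∂(Measure.comap Subtype.val (volume : Measure (Eu n))) := by
      rw [integral_subtype_comap (measurableSet_singleton _).compl f, restrict_compl_singleton]
    _ = ∫ z : Metric.sphere (0 : Eu n) 1 × Ioi (0 : ℝ), f (z.2.1 • z.1.1)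
          ∂((volume : Measure (Eu n)).toSphere.prod (Measure.volumeIoiPow (n - 1))) := by
      rw [← h.integral_comp (Homeomorph.measurableEmbedding _)]
      refine integral_congr_ae (Eventually.of_forall fun x => ?_)
      have : x = (homeomorphUnitSphereProd (Eu n)).symm (homeomorphUnitSphereProd (Eu n) x) := by
        simp
      conv_lhs => rw [this]
      rfl
    _ = ∫ r : Ioi (0 : ℝ), ∫ θ : Metric.sphere (0 : Eu n) 1, f (r.1 • θ.1)
          ∂(volume : Measure (Eu n)).toSphere ∂(Measure.volumeIoiPow (n - 1)) :=
      integral_prod_symm _ (integrable_polar hf)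
    _ = _ := by
      simp only [Measure.volumeIoiPow, ENNReal.ofReal]
      rw [integral_withDensity_eq_integral_smul
          ((measurable_subtype_coe.pow_const _).real_toNNReal),
        integral_subtype_comap measurableSet_Ioi fun a : ℝ => Real.toNNReal (a ^ (n - 1)) •
          ∫ θ : Metric.sphere (0 : Eu n) 1, f (a • θ.1) ∂(volume : Measure (Eu n)).toSphere]
      refine setIntegral_congr_fun measurableSet_Ioi fun r hr => ?_
      have hr' : (0 : ℝ) < r := hr
      simp only [NNReal.smul_def, Complex.real_smul]
      rw [Real.coe_toNNReal _ (pow_nonneg hr'.le _), Complex.ofReal_pow]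

/-- Polar coordinates on a rotationally invariant set. -/
theorem setIntegral_polar {n : ℕ} (hn : 0 < n) {f : Eu n → ℂ} {A : Set ℝ} (hA : MeasurableSet A)
    (hA0 : A ⊆ Ioi 0) (hf : IntegrableOn f {ξ | ‖ξ‖ ∈ A}) :
    ∫ ξ in {ξ : Eu n | ‖ξ‖ ∈ A}, f ξ = ∫ r in A, (r : ℂ) ^ (n - 1) *
      ∫ θ : Metric.sphere (0 : Eu n) 1, f (r • θ.1) ∂(volume : Measure (Eu n)).toSphere := by
  have hm : MeasurableSet {ξ : Eu n | ‖ξ‖ ∈ A} := measurable_norm hA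
  rw [← integral_indicator hm, integral_polar hn ((integrable_indicator_iff hm).2 hf)]
  conv_rhs => rw [← inter_eq_self_of_subset_right hA0, ← setIntegral_indicator hA]
  refine setIntegral_congr_fun measurableSet_Ioi fun r hr => ?_
  have hr0 : (0 : ℝ) < r := hr
  have hn' : ∀ θ : Metric.sphere (0 : Eu n) 1, ‖r • θ.1‖ = r := fun θ => by
    rw [norm_smul, norm_eq_of_mem_sphere, mul_one, Real.norm_of_nonneg hr0.le]
  by_cases h : r ∈ A
  · simp only [indicator, mem_ofPred_eq, hn', h, if_true]
  · simp [indicator, h, hn']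

theorem continuous_sphere_integral {n : ℕ} {f : Eu n → ℂ} (hf : Continuous f)
    {g : Metric.sphere (0 : Eu n) 1 → ℂ} (hg : Continuous g) :
    Continuous fun r : ℝ => ∫ θ : Metric.sphere (0 : Eu n) 1, f (r • θ.1) * g θ
      ∂(volume : Measure (Eu n)).toSphere := by
  have := continuous_parametric_integral_of_continuous
    (μ := (volume : Measure (Eu n)).toSphere)
    (f := fun (r : ℝ) (θ : Metric.sphere (0 : Eu n) 1) => f (r • θ.1) * g θ)
    (by fun_prop) (s := univ) isCompact_univ
  simpa using this

theorem ball_ae_eq {n : ℕ} (hn : 0 < n) (R : ℝ) :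
    (Metric.ball (0 : Eu n) R) =ᵐ[volume] {ξ : Eu n | ‖ξ‖ ∈ Ioo 0 R} := by
  have : Nonempty (Fin n) := ⟨⟨0, hn⟩⟩
  have h0 : ∀ᵐ ξ : Eu n, ξ ≠ 0 := by
    simp [ae_iff]
  filter_upwards [h0] with ξ hξ
  have : 0 < ‖ξ‖ := norm_pos_iff.2 hξ
  change (ξ ∈ Metric.ball (0 : Eu n) R) = (‖ξ‖ ∈ Ioo 0 R)
  simp [this]

theorem hasDerivAt_norm_line {n : ℕ} {ξ : Eu n} (hξ : ξ ≠ 0) (v : Eu n) :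
    HasDerivAt (fun t : ℝ => ‖ξ + t • v‖) (‖ξ‖⁻¹ * inner ℝ ξ v) 0 := by
  have h1 : HasDerivAt (fun t : ℝ => ξ + t • v) v 0 := by
    simpa using ((hasDerivAt_id (0 : ℝ)).smul_const v).const_add ξ
  have h2 := h1.norm_sq.sqrt (by simpa using hξ)
  simp only [Real.sqrt_sq (norm_nonneg _), zero_smul, add_zero] at h2
  convert h2 using 1
  field_simp

/-- The divergence theorem on a ball, tested against a continuous function `ψ` of the radius with
compact support in `(0, ∞)`: integration by parts against the radial function
`ξ ↦ ∫_{|ξ|}^M ψ`. Here `F R` is the integral of `∂_v f` over the ball of radius `R` in polar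
coordinates, and `G R` is the flux through its boundary. -/
theorem integral_radial_test {n : ℕ} (hn : 0 < n) {f : Eu n → ℂ} (hf : ContDiff ℝ 1 f)
    (v : Eu n) {ψ : ℝ → ℝ} (hψ : Continuous ψ) {δ M : ℝ} (hδ : 0 < δ) (hM : 0 < M)
    (h0 : ∀ r < δ, ψ r = 0) (h1 : ∀ r, M < r → ψ r = 0) {F G D : ℝ → ℂ}
    (hD : D = fun r : ℝ => (r : ℂ) ^ (n - 1) * ∫ θ : Metric.sphere (0 : Eu n) 1,
      fderiv ℝ f (r • θ.1) v ∂(volume : Measure (Eu n)).toSphere)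
    (hDc : Continuous D) (hF : ∀ r, HasDerivAt F (D r) r) (hF0 : F 0 = 0)
    (hG : G = fun r : ℝ => (r : ℂ) ^ (n - 1) * ∫ θ : Metric.sphere (0 : Eu n) 1,
      f (r • θ.1) * (inner ℝ θ.1 v : ℝ) ∂(volume : Measure (Eu n)).toSphere) :
    ∫ r in Ioi 0, (ψ r : ℂ) * F r = ∫ r in Ioi 0, (ψ r : ℂ) * G r := by
  have hfc : Continuous f := hf.continuous
  have hf'c : Continuous fun ξ => fderiv ℝ f ξ v :=
    (hf.continuous_fderiv one_ne_zero).clm_apply continuous_const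
  set φ : ℝ → ℝ := fun r => ∫ s in r..M, ψ s with hφ
  have hφd : ∀ r, HasDerivAt φ (-ψ r) r := fun r =>
    intervalIntegral.integral_hasDerivAt_left (hψ.intervalIntegrable _ _)
      hψ.stronglyMeasurable.stronglyMeasurableAtFilter hψ.continuousAt
  have hφc : Continuous φ := continuous_iff_continuousAt.2 fun r => (hφd r).continuousAt
  have hφM : ∀ r, M ≤ r → φ r = 0 := fun r hr => by
    simp only [hφ]
    rw [intervalIntegral.integral_symm, neg_eq_zero]
    refine intervalIntegral.integral_zero_ae (Eventually.of_forall fun s hs => ?_)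
    rw [uIoc_of_le hr] at hs
    exact h1 s hs.1
  have hφ0 : ∀ r, |r| < δ → φ r = φ 0 := fun r hr => by
    have : φ r = (∫ s in r..0, ψ s) + φ 0 :=
      (intervalIntegral.integral_add_adjacent_intervals (hψ.intervalIntegrable _ _)
        (hψ.intervalIntegrable _ _)).symm
    rw [this, intervalIntegral.integral_zero_ae, zero_add]
    refine Eventually.of_forall fun s hs => h0 s ?_
    have := abs_lt.1 hr
    rcases le_total r 0 with h | h
    · rw [uIoc_of_le h] at hs; linarith [hs.2]
    · rw [uIoc_of_ge h] at hs; linarith [hs.2]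
  -- `ψ r / r`, written so that continuity at `0` is evident.
  set κ : ℝ → ℝ := fun r => ψ r * (max r δ)⁻¹ with hκ
  have hκc : Continuous κ :=
    hψ.mul ((continuous_id.max continuous_const).inv₀ fun r => (lt_max_of_lt_right hδ).ne')
  have hκe : ∀ r, 0 < r → κ r * r = ψ r := fun r hr => by
    rcases lt_or_ge r δ with h | h
    · simp [hκ, h0 r h]
    · simp only [hκ, max_eq_left h]
      field_simp
  have hline : ∀ ξ : Eu n, HasLineDerivAt ℝ (fun ξ => (φ ‖ξ‖ : ℂ))
      (-((κ ‖ξ‖ * inner ℝ ξ v : ℝ) : ℂ)) ξ v := fun ξ => by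
    unfold HasLineDerivAt
    by_cases hξ : ξ = 0
    · subst hξ
      have : (fun t : ℝ => (φ ‖(0 : Eu n) + t • v‖ : ℂ)) =ᶠ[𝓝 0] fun _ => (φ 0 : ℂ) := by
        have hc : Tendsto (fun t : ℝ => ‖(0 : Eu n) + t • v‖) (𝓝 0) (𝓝 0) := by
          have : Continuous fun t : ℝ => ‖(0 : Eu n) + t • v‖ := by fun_prop
          simpa using this.tendsto 0
        filter_upwards [hc.eventually_lt_const hδ] with t ht
        rw [hφ0 _ (by rwa [abs_of_nonneg (norm_nonneg _)])]
      simpa using (hasDerivAt_const (0 : ℝ) (φ 0 : ℂ)).congr_of_eventuallyEq this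
    · have hp : 0 < ‖ξ‖ := norm_pos_iff.2 hξ
      have hpc : (‖ξ‖ : ℂ) ≠ 0 := by exact_mod_cast hp.ne'
      have h2 := (HasDerivAt.comp (0 : ℝ) (by simpa using hφd ‖ξ‖) (hasDerivAt_norm_line hξ v))
      have h3 := h2.ofReal_comp
      refine h3.congr_deriv ?_
      rw [← hκe _ hp]
      push_cast
      field_simp
  have hzero : ∀ ξ : Eu n, ξ ∉ Metric.closedBall (0 : Eu n) M → φ ‖ξ‖ = 0 ∧ κ ‖ξ‖ = 0 :=
    fun ξ hξ => by
      have : M < ‖ξ‖ := by simpa using hξ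
      exact ⟨hφM _ this.le, by simp [hκ, h1 _ this]⟩
  have hcpt : ∀ g : Eu n → ℂ, Continuous g → (∀ ξ ∉ Metric.closedBall (0 : Eu n) M, g ξ = 0) →
      Integrable g := fun g hg hg0 =>
    hg.integrable_of_hasCompactSupport (HasCompactSupport.intro (isCompact_closedBall 0 M) hg0)
  have hi1 : Integrable fun ξ : Eu n => (φ ‖ξ‖ : ℂ) * fderiv ℝ f ξ v :=
    hcpt _ (by fun_prop) fun ξ hξ => by simp [(hzero ξ hξ).1]
  have hi2 : Integrable fun ξ : Eu n => -((κ ‖ξ‖ * inner ℝ ξ v : ℝ) : ℂ) * f ξ :=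
    hcpt _ (by fun_prop) fun ξ hξ => by simp [(hzero ξ hξ).2]
  have hi3 : Integrable fun ξ : Eu n => (φ ‖ξ‖ : ℂ) * f ξ :=
    hcpt _ (by fun_prop) fun ξ hξ => by simp [(hzero ξ hξ).1]
  have key := integral_bilinear_hasLineDerivAt_right_eq_neg_left_of_integrable
    (μ := (volume : Measure (Eu n))) (B := ContinuousLinearMap.mul ℝ ℂ)
    (f := fun ξ => (φ ‖ξ‖ : ℂ)) (f' := fun ξ => -((κ ‖ξ‖ * inner ℝ ξ v : ℝ) : ℂ))
    (g := f) (g' := fun ξ => fderiv ℝ f ξ v) (v := v) hi2 hi1 hi3 (fun ξ _ => hline ξ)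
    (fun ξ _ => ((hf.differentiable one_ne_zero ξ).hasFDerivAt.hasLineDerivAt v))
  simp only [ContinuousLinearMap.mul_apply'] at key
  rw [integral_polar hn hi1, integral_polar hn hi2, ← integral_neg] at key
  have hnorm : ∀ r : ℝ, 0 < r → ∀ θ : Metric.sphere (0 : Eu n) 1, ‖r • θ.1‖ = r := fun r hr θ => by
    rw [norm_smul, norm_eq_of_mem_sphere, mul_one, Real.norm_of_nonneg hr.le]
  have hL : ∫ r in Ioi (0 : ℝ), (r : ℂ) ^ (n - 1) * ∫ θ : Metric.sphere (0 : Eu n) 1,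
      (φ ‖r • θ.1‖ : ℂ) * fderiv ℝ f (r • θ.1) v ∂(volume : Measure (Eu n)).toSphere
      = ∫ r in Ioi (0 : ℝ), (φ r : ℂ) * D r := by
    refine setIntegral_congr_fun measurableSet_Ioi fun r hr => ?_
    simp only [hnorm r hr, hD, integral_const_mul]
    ring
  have hR : ∫ r in Ioi (0 : ℝ), -((r : ℂ) ^ (n - 1) * ∫ θ : Metric.sphere (0 : Eu n) 1,
      -((κ ‖r • θ.1‖ * inner ℝ (r • θ.1) v : ℝ) : ℂ) * f (r • θ.1)
        ∂(volume : Measure (Eu n)).toSphere)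
      = ∫ r in Ioi (0 : ℝ), (ψ r : ℂ) * G r := by
    refine setIntegral_congr_fun measurableSet_Ioi fun r hr => ?_
    have : ∀ θ : Metric.sphere (0 : Eu n) 1,
        -((κ ‖r • θ.1‖ * inner ℝ (r • θ.1) v : ℝ) : ℂ) * f (r • θ.1)
        = -(ψ r : ℂ) * (f (r • θ.1) * (inner ℝ θ.1 v : ℝ)) := fun θ => by
      rw [hnorm r hr, ← hκe r hr, real_inner_smul_left]
      push_cast
      ring
    simp only [this, hG, integral_const_mul]
    ring
  rw [hL, hR] at key
  rw [← key]
  have hIoi : ∀ g : ℝ → ℂ, (∀ r, M < r → g r = 0) → ∫ r in Ioi (0 : ℝ), g r = ∫ r in (0)..M, g r :=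
    fun g hg => by
      rw [intervalIntegral.integral_of_le hM.le]
      refine (setIntegral_eq_of_subset_of_forall_sdiff_eq_zero measurableSet_Ioi
        Ioc_subset_Ioi_self fun r hr => hg r ?_)
      by_contra h
      exact hr.2 ⟨hr.1, not_lt.1 h⟩
  rw [hIoi _ fun r hr => by simp [h1 r hr], hIoi _ fun r hr => by simp [hφM r hr.le]]
  have hFc : Continuous F := continuous_iff_continuousAt.2 fun r => (hF r).continuousAt
  have hparts := intervalIntegral.integral_mul_deriv_eq_deriv_mul (a := 0) (b := M)
    (u := fun r => (φ r : ℂ)) (u' := fun r => ((-ψ r : ℝ) : ℂ)) (v := F) (v' := D)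
    (fun r _ => (hφd r).ofReal_comp) (fun r _ => hF r)
    ((by fun_prop : Continuous fun r => ((-ψ r : ℝ) : ℂ)).intervalIntegrable _ _)
    (hDc.intervalIntegrable _ _)
  rw [hparts, hφM M le_rfl, hF0]
  simp

/-- The divergence theorem on a ball: two continuous functions of the radius agree since they
agree when tested against smooth functions. -/
theorem integral_ball_fderiv {n : ℕ} (hn : 0 < n) {f : Eu n → ℂ} (hf : ContDiff ℝ 1 f)
    (v : Eu n) {R : ℝ} (hR : 0 < R) :
    ∫ ξ in Metric.ball 0 R, fderiv ℝ f ξ v = (R : ℂ) ^ (n - 1) *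
      ∫ θ : Metric.sphere (0 : Eu n) 1, f (R • θ.1) * (inner ℝ θ.1 v : ℝ)
        ∂(volume : Measure (Eu n)).toSphere := by
  have hf'c : Continuous fun ξ => fderiv ℝ f ξ v :=
    (hf.continuous_fderiv one_ne_zero).clm_apply continuous_const
  set D : ℝ → ℂ := fun r : ℝ => (r : ℂ) ^ (n - 1) * ∫ θ : Metric.sphere (0 : Eu n) 1,
      fderiv ℝ f (r • θ.1) v ∂(volume : Measure (Eu n)).toSphere with hD
  set G : ℝ → ℂ := fun r : ℝ => (r : ℂ) ^ (n - 1) * ∫ θ : Metric.sphere (0 : Eu n) 1,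
      f (r • θ.1) * (inner ℝ θ.1 v : ℝ) ∂(volume : Measure (Eu n)).toSphere with hG
  have hDc : Continuous D := by
    have := continuous_sphere_integral hf'c (g := fun _ => 1) continuous_const
    simp only [mul_one] at this
    exact (Complex.continuous_ofReal.pow _).mul this
  have hGc : Continuous G :=
    (Complex.continuous_ofReal.pow _).mul (continuous_sphere_integral hf.continuous (by fun_prop))
  set F : ℝ → ℂ := fun r => ∫ s in (0)..r, D s with hF
  have hFd : ∀ r, HasDerivAt F (D r) r := fun r => hDc.integral_hasStrictDerivAt 0 r |>.hasDerivAt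
  have hFc : Continuous F := continuous_iff_continuousAt.2 fun r => (hFd r).continuousAt
  have hae : ∀ᵐ r : ℝ, r ∈ Ioi (0 : ℝ) → F r - G r = 0 := by
    refine isOpen_Ioi.ae_eq_zero_of_integral_contDiff_smul_eq_zero
      ((hFc.sub hGc).locallyIntegrable.locallyIntegrableOn _) fun ψ hψ hψc hψs => ?_
    obtain ⟨M, hM⟩ := hψc.isCompact.isBounded.subset_closedBall (0 : ℝ)
    obtain ⟨δ, hδ, hδs⟩ := Metric.isOpen_iff.1 (isClosed_tsupport ψ).isOpen_compl 0
      (fun h => lt_irrefl (0 : ℝ) (hψs h))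
    have h0 : ∀ r < δ, ψ r = 0 := fun r hr => by
      by_contra h
      have hmem : r ∈ tsupport ψ := subset_tsupport ψ h
      have hr0 : 0 < r := hψs hmem
      exact hδs (by simpa [abs_of_pos hr0] using hr) hmem
    have h1 : ∀ r, max M 1 < r → ψ r = 0 := fun r hr => by
      by_contra h
      have hmem := hM (subset_tsupport ψ h)
      have hM' := le_max_left M 1
      simp only [Metric.mem_closedBall, dist_zero_right, Real.norm_eq_abs] at hmem
      linarith [le_abs_self r]
    have key := integral_radial_test hn hf v hψ.continuous hδ
      (lt_max_of_lt_right one_pos) h0 h1 hD hDc hFd (by simp [hF]) hG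
    have hψc' : HasCompactSupport fun r => (ψ r : ℂ) := hψc.comp_left Complex.ofReal_zero
    have hi : ∀ H : ℝ → ℂ, Continuous H → Integrable fun r => (ψ r : ℂ) * H r := fun H hH =>
      ((Complex.continuous_ofReal.comp hψ.continuous).mul hH).integrable_of_hasCompactSupport
        hψc'.mul_right
    rw [← setIntegral_eq_integral_of_forall_compl_eq_zero (s := Ioi (0 : ℝ))
      fun r hr => by rw [h0 r (lt_of_le_of_lt (not_lt.1 hr) hδ), zero_smul]]
    simp only [Complex.real_smul, mul_sub]
    rw [integral_sub (hi F hFc).integrableOn (hi G hGc).integrableOn, key, sub_self]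
  have heq : EqOn (fun r => F r - G r) (fun _ => 0) (Ioi (0 : ℝ)) :=
    Measure.eqOn_open_of_ae_eq ((ae_restrict_iff' measurableSet_Ioi).2 hae) isOpen_Ioi
      (hFc.sub hGc).continuousOn continuousOn_const
  have hFG : F R = G R := sub_eq_zero.1 (heq hR)
  rw [setIntegral_congr_set (ball_ae_eq hn R), setIntegral_polar hn measurableSet_Ioo
    (fun r hr => hr.1), ← integral_Ioc_eq_integral_Ioo, ← intervalIntegral.integral_of_le hR.le]
  · exact hFG
  · exact (hf'c.continuousOn.integrableOn_compact (isCompact_closedBall 0 R)).mono_set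
      fun ξ hξ => by simpa using hξ.2.le

/-! ### Integrals of derivatives of functions with compact support in `U` -/

theorem setIntegral_fderiv_eq_zero {n : ℕ} {U K : Set (Eu n)} (hU : IsOpen U) (hK : IsCompact K)
    (hKU : K ⊆ U) {h : Eu n → ℂ} (hh : ContDiffOn ℝ 1 h U) (h0 : ∀ x ∈ U \ K, h x = 0)
    (e : Eu n) : ∫ x in U, fderiv ℝ h x e = 0 := by
  set k : Eu n → ℂ := U.indicator h with hk
  have hk0 : ∀ x ∉ K, k x = 0 := fun x hx => by
    by_cases hxU : x ∈ U
    · rw [hk, indicator_of_mem hxU, h0 x ⟨hxU, hx⟩]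
    · rw [hk, indicator_of_notMem hxU]
  have heq : ∀ x ∈ U, k =ᶠ[𝓝 x] h := fun x hx => by
    filter_upwards [hU.mem_nhds hx] with y hy
    rw [hk, indicator_of_mem hy]
  have heq0 : ∀ x ∉ K, k =ᶠ[𝓝 x] fun _ => 0 := fun x hx => by
    filter_upwards [hK.isClosed.isOpen_compl.mem_nhds hx] with y hy
    exact hk0 y hy
  have hkc : ContDiff ℝ 1 k := contDiff_iff_contDiffAt.2 fun x => by
    by_cases hxU : x ∈ U
    · exact (hh.contDiffAt (hU.mem_nhds hxU)).congr_of_eventuallyEq (heq x hxU)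
    · exact contDiffAt_const.congr_of_eventuallyEq (heq0 x fun hx => hxU (hKU hx))
  have hkcpt : HasCompactSupport k := HasCompactSupport.intro hK hk0
  have hdc : Continuous fun x => fderiv ℝ k x e :=
    (hkc.continuous_fderiv one_ne_zero).clm_apply continuous_const
  have hdi : Integrable fun x => fderiv ℝ k x e :=
    hdc.integrable_of_hasCompactSupport (HasCompactSupport.intro hK fun x hx => by
      rw [(heq0 x hx).fderiv_eq]; simp)
  have key := integral_mul_fderiv_eq_neg_fderiv_mul_of_integrable (𝕜 := ℂ)
    (μ := (volume : Measure (Eu n))) (f := fun _ => 1) (g := k) (v := e) (by simp)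
    (by simpa using hdi) (by simpa using hkc.continuous.integrable_of_hasCompactSupport hkcpt)
    (fun x _ => differentiableAt_const _) (fun x _ => hkc.differentiable one_ne_zero x)
  simp only [one_mul, fderiv_fun_const, Pi.zero_apply, zero_apply, zero_mul,
    integral_zero, neg_zero] at key
  rw [← setIntegral_eq_integral_of_forall_compl_eq_zero (s := U)
    fun x hx => by rw [(heq0 x fun hxK => hx (hKU hxK)).fderiv_eq]; simp] at key
  rw [← key]
  exact setIntegral_congr_fun hU.measurableSet fun x hx => by
    rw [(heq x hx).fderiv_eq]

theorem fderiv_apply_fst {n : ℕ} {F : Ph n → ℂ} {x ξ : Eu n} (hF : DifferentiableAt ℝ F (x, ξ))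
    (e : Eu n) : fderiv ℝ F (x, ξ) (e, 0) = fderiv ℝ (fun x' => F (x', ξ)) x e := by
  have h := (hF.hasFDerivAt.comp x (hasFDerivAt_prodMk_left (𝕜 := ℝ) x ξ)).fderiv
  change fderiv ℝ (fun x' => F (x', ξ)) x = _ at h
  rw [h]
  simp

theorem fderiv_apply_snd {n : ℕ} {F : Ph n → ℂ} {x ξ : Eu n} (hF : DifferentiableAt ℝ F (x, ξ))
    (e : Eu n) : fderiv ℝ F (x, ξ) (0, e) = fderiv ℝ (fun ξ' => F (x, ξ')) ξ e := by
  have h := (hF.hasFDerivAt.comp ξ (hasFDerivAt_prodMk_right (𝕜 := ℝ) x ξ)).fderiv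
  change fderiv ℝ (fun ξ' => F (x, ξ')) ξ = _ at h
  rw [h]
  simp

section

variable {n : ℕ} {U K W : Set (Eu n)} {F : Ph n → ℂ}

theorem continuousOn_fderiv_apply (hU : IsOpen U) (hW : IsOpen W)
    (hF : ContDiffOn ℝ ∞ F (U ×ˢ W)) (v : Ph n) :
    ContinuousOn (fun z => fderiv ℝ F z v) (U ×ˢ W) :=
  (hF.continuousOn_fderiv_of_isOpen (hU.prod hW) (by simp)).clm_apply continuousOn_const

theorem differentiableAt_of_contDiffOn_prod (hU : IsOpen U) (hW : IsOpen W)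
    (hF : ContDiffOn ℝ ∞ F (U ×ˢ W)) {x ξ : Eu n} (hx : x ∈ U) (hξ : ξ ∈ W) :
    DifferentiableAt ℝ F (x, ξ) :=
  (hF.contDiffAt ((hU.prod hW).mem_nhds ⟨hx, hξ⟩)).differentiableAt (by simp)

/-- A function on `U × V` supported in `K × V` is integrable if it is dominated there by an
integrable function of the second variable. -/
theorem integrable_prod_of_compact_support {Y : Type*} [TopologicalSpace Y] [MeasurableSpace Y]
    [BorelSpace Y] [SecondCountableTopology Y] {μ : Measure Y} [SFinite μ] {V : Set Y}
    (hV : MeasurableSet V) (hU : IsOpen U)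
    (hK : IsCompact K) {D : Eu n × Y → ℂ} (hD : ContinuousOn D (U ×ˢ V))
    (h0 : ∀ x ∈ U \ K, ∀ y ∈ V, D (x, y) = 0) {g : Y → ℝ} (hg : IntegrableOn g V μ)
    (hb : ∀ x ∈ K, ∀ y ∈ V, ‖D (x, y)‖ ≤ g y) :
    Integrable D (((volume : Measure (Eu n)).restrict U).prod (μ.restrict V)) := by
  have hd : Integrable (fun z : Eu n × Y => K.indicator (fun _ => (1 : ℝ)) z.1 * g z.2)
      (((volume : Measure (Eu n)).restrict U).prod (μ.restrict V)) := by
    refine Integrable.mul_prod ?_ hg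
    exact (((integrable_indicator_iff hK.measurableSet).2
      (integrableOn_const hK.measure_lt_top.ne))).restrict
  refine hd.mono' ?_ ?_
  · rw [Measure.prod_restrict]
    exact hD.aestronglyMeasurable (hU.measurableSet.prod hV)
  · rw [Measure.prod_restrict]
    filter_upwards [ae_restrict_mem (hU.measurableSet.prod hV)] with z hz
    by_cases hzK : z.1 ∈ K
    · simpa [hzK] using hb z.1 hzK z.2 hz.2
    · simp [hzK, h0 z.1 ⟨hz.1, hzK⟩ z.2 hz.2]

/-- By Fubini's theorem, averages over a parameter `ξ = j y` of `∂_x F(x, ξ)` have integral zero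
over `U` when `F` has compact support in `x`. -/
theorem integral_fderiv_fst_eq_zero (hU : IsOpen U) (hK : IsCompact K) (hKU : K ⊆ U)
    (hW : IsOpen W) (hF : ContDiffOn ℝ ∞ F (U ×ˢ W))
    (h0 : ∀ x ∈ U \ K, ∀ ξ ∈ W, F (x, ξ) = 0) (e : Eu n)
    {Y : Type*} [TopologicalSpace Y] [MeasurableSpace Y] [BorelSpace Y]
    [SecondCountableTopology Y] {μ : Measure Y} [SFinite μ] {j : Y → Eu n} (hj : Continuous j)
    {V : Set Y} (hV : MeasurableSet V) (hjV : MapsTo j V W) {g : Y → ℝ}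
    (hg : IntegrableOn g V μ)
    (hb : ∀ x ∈ K, ∀ y ∈ V, ‖fderiv ℝ F (x, j y) (e, 0)‖ ≤ g y) :
    IntegrableOn (fun x => ∫ y in V, fderiv ℝ F (x, j y) (e, 0) ∂μ) U ∧
      ∫ x in U, ∫ y in V, fderiv ℝ F (x, j y) (e, 0) ∂μ = 0 := by
  have hcont : ContinuousOn (fun z : Eu n × Y => fderiv ℝ F (z.1, j z.2) (e, 0)) (U ×ˢ V) :=
    (continuousOn_fderiv_apply hU hW hF (e, 0)).comp
      (f := fun z : Eu n × Y => (z.1, j z.2)) (by fun_prop) fun z hz => ⟨hz.1, hjV hz.2⟩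
  have hzero : ∀ x ∈ U \ K, ∀ y ∈ V, fderiv ℝ F (x, j y) (e, 0) = 0 := fun x hx y hy => by
    have : F =ᶠ[𝓝 (x, j y)] fun _ => 0 := by
      filter_upwards [((hU.sdiff hK.isClosed).prod hW).mem_nhds ⟨hx, hjV hy⟩] with z hz
      exact h0 z.1 hz.1 z.2 hz.2
    rw [this.fderiv_eq]
    simp
  have hint := integrable_prod_of_compact_support hV hU hK hcont hzero hg hb
  refine ⟨hint.integral_prod_left, ?_⟩
  rw [integral_integral_swap hint]
  refine integral_eq_zero_of_ae ?_
  filter_upwards [ae_restrict_mem hV] with y hy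
  have hs : ContDiffOn ℝ 1 (fun x => F (x, j y)) U :=
    (hF.of_le (by simp)).comp (f := fun x => (x, j y)) (by fun_prop) fun x hx => ⟨hx, hjV hy⟩
  rw [Pi.zero_apply, ← setIntegral_fderiv_eq_zero hU hK hKU hs (fun x hx => h0 x hx _ (hjV hy)) e]
  exact setIntegral_congr_fun hU.measurableSet fun x hx =>
    fderiv_apply_fst (differentiableAt_of_contDiffOn_prod hU hW hF hx (hjV hy)) e

end

/-! ### Expansions of classical symbols away from the zero section -/

section

variable {n : ℕ} {U : Set (Eu n)} {χ : Ph n → ℝ} {m : ℂ} {σ : Ph n → ℂ} {τ : ℕ → Ph n → ℂ}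

theorem IsSymbol.exists_bound {m : ℝ} (h : IsSymbol U m σ) {K : Set (Eu n)} (hK : IsCompact K)
    (hKU : K ⊆ U) : ∃ C : ℝ, ∀ x ∈ K, ∀ ξ : Eu n, ‖σ (x, ξ)‖ ≤ C * (1 + ‖ξ‖) ^ m := by
  obtain ⟨C, hC⟩ := h.2 K hK hKU 0 Fin.elim0
  exact ⟨C, fun x hx ξ => by simpa using hC x hx ξ⟩

theorem IsSymbol.exists_bound_fderiv_fst {m : ℝ} (h : IsSymbol U m σ) {K : Set (Eu n)}
    (hK : IsCompact K) (hKU : K ⊆ U) (i : Fin n) : ∃ C : ℝ, ∀ x ∈ K, ∀ ξ : Eu n,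
      ‖fderiv ℝ σ (x, ξ) (EuclideanSpace.single i 1, 0)‖ ≤ C * (1 + ‖ξ‖) ^ m := by
  obtain ⟨C, hC⟩ := h.2 K hK hKU 1 fun _ => Sum.inl i
  exact ⟨C, fun x hx ξ => by simpa [iteratedFDeriv_one_apply, coordVec] using hC x hx ξ⟩

theorem HasClassicalExpansion.exists_bound (hχ : IsExcision U χ)
    (h : HasClassicalExpansion U χ m σ τ) {K : Set (Eu n)} (hK : IsCompact K) (hKU : K ⊆ U)
    (N : ℕ) : ∃ C : ℝ, ∀ x ∈ K, ∀ ξ : Eu n, 1 ≤ ‖ξ‖ →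
      ‖σ (x, ξ) - ∑ i ∈ Finset.range (N + 1), τ i (x, ξ)‖ ≤ C * (1 + ‖ξ‖) ^ (m.re - N - 1) := by
  obtain ⟨C, hC⟩ := (h.2.2 N).exists_bound hK hKU
  refine ⟨C, fun x hx ξ hξ => ?_⟩
  simpa [hχ.2.2 x (hKU hx) ξ hξ] using hC x hx ξ

theorem isOpen_one_lt_norm : IsOpen {ξ : Eu n | 1 < ‖ξ‖} :=
  isOpen_lt continuous_const continuous_norm

theorem one_lt_norm_subset : {ξ : Eu n | 1 < ‖ξ‖} ⊆ {0}ᶜ := fun ξ (hξ : 1 < ‖ξ‖) h0 => by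
  rw [mem_singleton_iff.1 h0, norm_zero] at hξ
  linarith

theorem HasClassicalExpansion.exists_bound_fderiv_fst (hU : IsOpen U) (hχ : IsExcision U χ)
    (h : HasClassicalExpansion U χ m σ τ) {K : Set (Eu n)} (hK : IsCompact K) (hKU : K ⊆ U)
    (N : ℕ) (i : Fin n) : ∃ C : ℝ, ∀ x ∈ K, ∀ ξ : Eu n, 1 < ‖ξ‖ →
      ‖fderiv ℝ (fun p => σ p - ∑ k ∈ Finset.range (N + 1), τ k p) (x, ξ)
        (EuclideanSpace.single i 1, 0)‖ ≤ C * (1 + ‖ξ‖) ^ (m.re - N - 1) := by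
  obtain ⟨C, hC⟩ := (h.2.2 N).exists_bound_fderiv_fst hK hKU i
  refine ⟨C, fun x hx ξ hξ => ?_⟩
  have : (fun p => σ p - ∑ k ∈ Finset.range (N + 1), τ k p) =ᶠ[𝓝 (x, ξ)]
      fun p => σ p - ∑ k ∈ Finset.range (N + 1), (χ p : ℂ) * τ k p := by
    filter_upwards [(hU.prod isOpen_one_lt_norm).mem_nhds ⟨hKU hx, hξ⟩] with p hp
    have hp2 : 1 < ‖p.2‖ := hp.2
    have : χ p = 1 := hχ.2.2 p.1 hp.1 p.2 hp2.le
    simp [this]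
  rw [this.fderiv_eq]
  exact hC x hx ξ

theorem continuous_fibre_of_contDiffOn {F : Ph n → ℂ} (hF : ContDiffOn ℝ ∞ F (U ×ˢ univ))
    {x : Eu n} (hx : x ∈ U) : Continuous fun ξ => F (x, ξ) :=
  hF.continuousOn.comp_continuous (by fun_prop) fun _ => ⟨hx, mem_univ _⟩

theorem continuous_sphere_of_continuousOn {F : Ph n → ℂ} (hF : ContinuousOn F (U ×ˢ {0}ᶜ))
    {x : Eu n} (hx : x ∈ U) : Continuous fun θ : Metric.sphere (0 : Eu n) 1 => F (x, θ.1) :=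
  hF.comp_continuous (by fun_prop) fun θ => ⟨hx, ne_zero_of_mem_unit_sphere θ⟩

theorem integrable_of_continuous_sphere {μ : Measure (Metric.sphere (0 : Eu n) 1)}
    [IsFiniteMeasure μ] {f : Metric.sphere (0 : Eu n) 1 → ℂ} (hf : Continuous f) :
    Integrable f μ :=
  hf.integrable_of_hasCompactSupport (HasCompactSupport.of_compactSpace f)

/-- The component of degree `s` in the expansion `∑ i, τ i`, where `τ i` has degree `m - i`, as a
sum over any range containing the only index that can contribute. -/
theorem component_eq_sum_range {m s : ℂ} (τ : ℕ → Ph n → ℂ) {N : ℕ} (hN : m.re - s.re < N + 1)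
    (p : Ph n) : ∑ᶠ (i : ℕ) (_ : m - (i : ℂ) = s), τ i p
      = ∑ i ∈ Finset.range (N + 1), if m - (i : ℂ) = s then τ i p else 0 := by
  classical
  simp only [finsum_eq_if]
  refine finsum_eq_sum_of_support_subset _ fun i hi => ?_
  have hi' : m - (i : ℂ) = s := by
    by_contra h
    simp [h] at hi
  have : m.re - i = s.re := by simpa using congrArg Complex.re hi'
  simp only [Finset.coe_range, mem_Iio]
  have : (i : ℝ) < N + 1 := by linarith
  exact_mod_cast this

theorem HasClassicalExpansion.continuousOn_component (h : HasClassicalExpansion U χ m σ τ)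
    (s : ℂ) : ContinuousOn (fun p => ∑ᶠ (i : ℕ) (_ : m - (i : ℂ) = s), τ i p) (U ×ˢ {0}ᶜ) := by
  obtain ⟨N, hN⟩ := exists_nat_gt (m.re - s.re)
  simp only [component_eq_sum_range τ (show m.re - s.re < N + 1 by linarith)]
  refine continuousOn_finsetSum _ fun i _ => ?_
  split_ifs
  · exact (h.2.1 i).1.continuousOn
  · exact continuousOn_const

/-- The spherical means of a classical symbol, divided by `t ^ s`, have a finite part, namely the
mean of the component of degree `s`. A Dirac mass for `μ` shows that a symbol determines its
components; the surface measure computes the boundary terms in the divergence theorem. -/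
theorem HasClassicalExpansion.hasFinitePart_sphere (hχ : IsExcision U χ)
    (h : HasClassicalExpansion U χ m σ τ) {x : Eu n} (hx : x ∈ U)
    (μ : Measure (Metric.sphere (0 : Eu n) 1)) [IsFiniteMeasure μ]
    {g : Metric.sphere (0 : Eu n) 1 → ℂ} (hg : Continuous g) (s : ℂ) :
    HasFinitePart (fun t => (t : ℂ) ^ (-s) * ∫ θ, σ (x, t • θ.1) * g θ ∂μ)
      (∫ θ, (∑ᶠ (i : ℕ) (_ : m - (i : ℂ) = s), τ i (x, θ.1)) * g θ ∂μ) := by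
  classical
  -- `m.re - s.re < N` makes the remainder `o(t ^ s)`; `m.re < N` makes its order negative, so that
  -- `1 + t` may be replaced by `t` in the symbol estimate.
  obtain ⟨N, hN⟩ := exists_nat_gt (max (m.re - s.re) m.re)
  have hN1 : m.re - s.re < N := (le_max_left _ _).trans_lt hN
  have hN2 : m.re < N := (le_max_right _ _).trans_lt hN
  obtain ⟨C, hC⟩ := h.exists_bound hχ (isCompact_singleton (x := x)) (by simpa using hx) N
  have hτi : ∀ i, Integrable (fun θ : Metric.sphere (0 : Eu n) 1 => τ i (x, θ.1) * g θ) μ :=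
    fun i => integrable_of_continuous_sphere
      ((continuous_sphere_of_continuousOn (h.2.1 i).1.continuousOn hx).mul hg)
  set A : ℕ → ℂ := fun i => ∫ θ, τ i (x, θ.1) * g θ ∂μ with hA
  set E : ℝ → ℂ := fun t => (t : ℂ) ^ (-s) * ∫ θ, (σ (x, t • θ.1)
    - ∑ i ∈ Finset.range (N + 1), τ i (x, t • θ.1)) * g θ ∂μ with hE
  have hE0 : Tendsto E atTop (𝓝 0) := by
    have hlim : Tendsto (fun t : ℝ => t ^ (-(s.re - (m.re - N - 1))) * (C * ∫ θ, ‖g θ‖ ∂μ))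
        atTop (𝓝 0) := by
      simpa using (tendsto_rpow_neg_atTop
        (show 0 < s.re - (m.re - N - 1) by linarith)).mul_const (C * ∫ θ, ‖g θ‖ ∂μ)
    refine squeeze_zero_norm' ?_ hlim
    filter_upwards [eventually_ge_atTop 1] with t ht
    have ht0 : 0 < t := by linarith
    have hb : ∀ θ : Metric.sphere (0 : Eu n) 1, ‖(σ (x, t • θ.1)
        - ∑ i ∈ Finset.range (N + 1), τ i (x, t • θ.1)) * g θ‖
        ≤ C * t ^ (m.re - N - 1) * ‖g θ‖ := fun θ => by
      have hnt : ‖t • θ.1‖ = t := by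
        rw [norm_smul, norm_eq_of_mem_sphere, mul_one, Real.norm_of_nonneg ht0.le]
      have hb := hC x rfl (t • θ.1) (by rwa [hnt])
      rw [hnt] at hb
      have hC0 : 0 ≤ C := nonneg_of_mul_nonneg_left ((norm_nonneg _).trans hb) (by positivity)
      rw [norm_mul]
      refine mul_le_mul_of_nonneg_right (hb.trans (mul_le_mul_of_nonneg_left ?_ hC0))
        (norm_nonneg _)
      exact Real.rpow_le_rpow_of_nonpos ht0 (by linarith) (by linarith)
    rw [hE, norm_mul, Complex.norm_cpow_eq_rpow_re_of_pos ht0]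
    have hI := norm_integral_le_of_norm_le
      ((integrable_of_continuous_sphere (μ := μ) hg).norm.const_mul (C * t ^ (m.re - N - 1)))
      (Eventually.of_forall hb)
    rw [integral_const_mul] at hI
    calc _ ≤ t ^ (-s).re * (C * t ^ (m.re - N - 1) * ∫ θ, ‖g θ‖ ∂μ) := by gcongr
      _ = (t ^ (-s).re * t ^ (m.re - N - 1)) * (C * ∫ θ, ‖g θ‖ ∂μ) := by ring
      _ = _ := by
        rw [← Real.rpow_add ht0]
        congr 2
        simp
        ring
  have hpow : ∀ i : ℕ, HasFinitePart (fun t : ℝ => A i * (t : ℂ) ^ (m - i - s))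
      (if m - (i : ℂ) = s then A i else 0) := fun i => by
    split_ifs with his
    · simpa [his] using hasFinitePart_const (A i)
    · simpa using (hasFinitePart_cpow (sub_ne_zero.2 his)).const_mul (A i)
  have hsum := (HasFinitePart.sum (Finset.range (N + 1)) fun i _ => hpow i).add
    (hasFinitePart_of_tendsto hE0)
  have hval : ∑ i ∈ Finset.range (N + 1), (if m - (i : ℂ) = s then A i else 0) + 0
      = ∫ θ, (∑ᶠ (i : ℕ) (_ : m - (i : ℂ) = s), τ i (x, θ.1)) * g θ ∂μ := by
    simp only [component_eq_sum_range τ (show m.re - s.re < N + 1 by linarith), Finset.sum_mul,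
      add_zero]
    rw [integral_finsetSum]
    · refine Finset.sum_congr rfl fun i _ => ?_
      split_ifs <;> simp [hA]
    · intro i _
      split_ifs
      · exact hτi i
      · simp
  rw [← hval]
  refine hsum.congr' ?_
  filter_upwards [eventually_gt_atTop 0] with t ht
  have htc : (t : ℂ) ≠ 0 := by exact_mod_cast ht.ne'
  have hhom : ∀ (i : ℕ) (θ : Metric.sphere (0 : Eu n) 1),
      τ i (x, t • θ.1) = (t : ℂ) ^ (m - i) * τ i (x, θ.1) := fun i θ =>
    (h.2.1 i).2 x hx θ.1 (ne_zero_of_mem_unit_sphere θ) t ht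
  have hσi : Integrable (fun θ : Metric.sphere (0 : Eu n) 1 => σ (x, t • θ.1) * g θ) μ := by
    refine integrable_of_continuous_sphere (Continuous.mul ?_ hg)
    exact (continuous_fibre_of_contDiffOn h.1.1 hx).comp (by fun_prop)
  have hsi : ∀ i ∈ Finset.range (N + 1), Integrable
      (fun θ : Metric.sphere (0 : Eu n) 1 => τ i (x, t • θ.1) * g θ) μ := fun i _ => by
    simp only [hhom, mul_assoc]
    exact (hτi i).const_mul _
  simp only [hE, sub_mul, Finset.sum_mul]
  rw [integral_sub hσi (integrable_finsetSum _ hsi), integral_finsetSum _ hsi, mul_sub,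
    Finset.mul_sum]
  have : ∀ i, (t : ℂ) ^ (-s) * ∫ θ, τ i (x, t • θ.1) * g θ ∂μ = A i * (t : ℂ) ^ (m - i - s) :=
    fun i => by
      simp only [hhom, mul_assoc, integral_const_mul]
      rw [sub_eq_add_neg (m - (i : ℂ)) s, Complex.cpow_add _ _ htc]
      ring
  simp only [this]
  ring

theorem IsHomogComponent.hasFinitePart_sphere (hχ : IsExcision U χ) {s : ℂ} {b : Ph n → ℂ}
    (h : IsHomogComponent U χ s σ b) {x : Eu n} (hx : x ∈ U)
    (μ : Measure (Metric.sphere (0 : Eu n) 1)) [IsFiniteMeasure μ]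
    {g : Metric.sphere (0 : Eu n) 1 → ℂ} (hg : Continuous g) :
    HasFinitePart (fun t => (t : ℂ) ^ (-s) * ∫ θ, σ (x, t • θ.1) * g θ ∂μ)
      (∫ θ, b (x, θ.1) * g θ ∂μ) := by
  obtain ⟨L, m, σ', e, he, hσ, hb⟩ := h
  have hsum := HasFinitePart.sum Finset.univ fun l _ => (he l).hasFinitePart_sphere hχ hx μ hg s
  have hval : ∫ θ, b (x, θ.1) * g θ ∂μ = ∑ l, ∫ θ,
      (∑ᶠ (i : ℕ) (_ : m l - (i : ℂ) = s), e l i (x, θ.1)) * g θ ∂μ := by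
    rw [← integral_finsetSum]
    · refine integral_congr_ae (Eventually.of_forall fun θ => ?_)
      simp only [hb x hx θ.1 (ne_zero_of_mem_unit_sphere θ), Finset.sum_mul]
    · exact fun l _ => integrable_of_continuous_sphere
        ((continuous_sphere_of_continuousOn ((he l).continuousOn_component s) hx).mul hg)
  rw [hval]
  refine hsum.congr' (Eventually.of_forall fun t => ?_)
  simp only [hσ x hx, Finset.sum_mul]
  rw [integral_finsetSum, Finset.mul_sum]
  exact fun l _ => integrable_of_continuous_sphere
    (((continuous_fibre_of_contDiffOn (he l).1.1 hx).comp (by fun_prop)).mul hg)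

theorem IsHomogComponent.continuousOn {s : ℂ} {b : Ph n → ℂ} (h : IsHomogComponent U χ s σ b) :
    ContinuousOn b (U ×ˢ {0}ᶜ) := by
  obtain ⟨L, m, σ', e, he, -, hb⟩ := h
  exact (continuousOn_finsetSum Finset.univ fun l _ => (he l).continuousOn_component s).congr
    fun p hp => hb p.1 hp.1 p.2 hp.2

theorem IsHomogComponent.eq_zero (hχ : IsExcision U χ) {s : ℂ} {b : Ph n → ℂ}
    (h : IsHomogComponent U χ s σ b) {x : Eu n} (hx : x ∈ U) (h0 : ∀ ξ, σ (x, ξ) = 0)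
    (θ : Metric.sphere (0 : Eu n) 1) : b (x, θ.1) = 0 := by
  have := h.hasFinitePart_sphere hχ hx (Measure.dirac θ) (g := fun _ => 1) continuous_const
  simp only [h0, integral_zero, mul_zero, integral_dirac, mul_one] at this
  exact this.unique (hasFinitePart_const 0)

theorem HasClassicalExpansion.isHomogComponent (h : HasClassicalExpansion U χ m σ τ) (i : ℕ) :
    IsHomogComponent U χ (m - i) σ (τ i) := by
  refine ⟨1, fun _ => m, fun _ => σ, fun _ => τ, fun _ => h, by simp, fun x _ ξ _ => ?_⟩
  simp

theorem HasClassicalExpansion.eq_zero (hχ : IsExcision U χ) (h : HasClassicalExpansion U χ m σ τ)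
    {x : Eu n} (hx : x ∈ U) (h0 : ∀ ξ, σ (x, ξ) = 0) (i : ℕ) {ξ : Eu n} (hξ : ξ ≠ 0) :
    τ i (x, ξ) = 0 := by
  have hp : 0 < ‖ξ‖ := norm_pos_iff.2 hξ
  have h1 := (h.isHomogComponent i).eq_zero hχ hx h0 ⟨‖ξ‖⁻¹ • ξ, by
    rw [mem_sphere_zero_iff_norm, norm_smul, norm_inv, norm_norm, inv_mul_cancel₀ hp.ne']⟩
  have h2 := (h.2.1 i).2 x hx (‖ξ‖⁻¹ • ξ) (smul_ne_zero (inv_ne_zero hp.ne') hξ) ‖ξ‖ hp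
  rw [smul_smul, mul_inv_cancel₀ hp.ne', one_smul] at h2
  rw [h2, h1, mul_zero]

end

/-! ### Cut-off integrals of derivatives of symbols -/

section

variable {n : ℕ} {U : Set (Eu n)} {χ : Ph n → ℝ} {m : ℂ} {σ : Ph n → ℂ} {τ : ℕ → Ph n → ℂ}

theorem IsPosHomogeneous.fderiv_fst (hU : IsOpen U) {s : ℂ} {τ : Ph n → ℂ}
    (h : IsPosHomogeneous U s τ) {x : Eu n} (hx : x ∈ U) {ξ : Eu n} (hξ : ξ ≠ 0) {t : ℝ}
    (ht : 0 < t) (e : Eu n) :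
    fderiv ℝ τ (x, t • ξ) (e, 0) = (t : ℂ) ^ s * fderiv ℝ τ (x, ξ) (e, 0) := by
  have hd : ∀ ζ : Eu n, ζ ≠ 0 → DifferentiableAt ℝ τ (x, ζ) := fun ζ hζ =>
    differentiableAt_of_contDiffOn_prod hU isOpen_compl_singleton h.1 hx hζ
  have hs : DifferentiableAt ℝ (fun x' => τ (x', ξ)) x :=
    (hd ξ hξ).comp (f := fun x' => (x', ξ)) x (by fun_prop)
  rw [fderiv_apply_fst (hd _ (smul_ne_zero ht.ne' hξ)), fderiv_apply_fst (hd _ hξ)]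
  have : (fun x' => τ (x', t • ξ)) =ᶠ[𝓝 x] fun x' => (t : ℂ) ^ s * τ (x', ξ) := by
    filter_upwards [hU.mem_nhds hx] with x' hx'
    exact h.2 x' hx' ξ hξ t ht
  rw [this.fderiv_eq, fderiv_const_mul hs]
  simp

/-- Cut-off integrals of `x`-derivatives: splitting the fibre at `|ξ| = 1`, and the symbol for
`|ξ| > 1` into homogeneous terms and an integrable remainder, exhibits the finite part as a sum of
averages of `x`-derivatives of functions with compact support in `x`. -/
theorem HasClassicalExpansion.exists_finitePart_fderiv_fst (hn : 0 < n) (hU : IsOpen U)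
    (hχ : IsExcision U χ) (h : HasClassicalExpansion U χ m σ τ) {K : Set (Eu n)}
    (hK : IsCompact K) (hKU : K ⊆ U) (h0 : ∀ x ∈ U \ K, ∀ ξ, σ (x, ξ) = 0) (i : Fin n) :
    ∃ G : Eu n → ℂ, (∀ x ∈ U, HasFinitePart (fun R => ∫ ξ in Metric.ball (0 : Eu n) R,
      fderiv ℝ σ (x, ξ) (EuclideanSpace.single i 1, 0)) (G x)) ∧
      IntegrableOn G U ∧ ∫ x in U, G x = 0 := by
  -- The remainder then has order `m.re - N - 1 < -n` and is integrable over the fibre.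
  obtain ⟨N, hN⟩ := exists_nat_gt (n + m.re)
  set e : Eu n := EuclideanSpace.single i 1 with he
  set V : Set (Eu n) := {ξ | 1 < ‖ξ‖} with hV
  have hVo : IsOpen V := isOpen_one_lt_norm
  set ρ : Ph n → ℂ := fun p => σ p - ∑ k ∈ Finset.range (N + 1), τ k p with hρ
  have hτV : ∀ k, ContDiffOn ℝ ∞ (τ k) (U ×ˢ V) := fun k =>
    (h.2.1 k).1.mono (prod_mono le_rfl one_lt_norm_subset)
  have hρV : ContDiffOn ℝ ∞ ρ (U ×ˢ V) :=
    (h.1.1.mono (prod_mono le_rfl (subset_univ _))).sub (ContDiffOn.sum fun k _ => hτV k)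
  have hτ0 : ∀ k, ∀ x ∈ U \ K, ∀ ξ ∈ ({0}ᶜ : Set (Eu n)), τ k (x, ξ) = 0 := fun k x hx ξ hξ =>
    h.eq_zero hχ hx.1 (h0 x hx) k hξ
  have hρ0 : ∀ x ∈ U \ K, ∀ ξ ∈ V, ρ (x, ξ) = 0 := fun x hx ξ hξ => by
    simp only [hρ, h0 x hx, zero_sub, neg_eq_zero]
    exact Finset.sum_eq_zero fun k _ => hτ0 k x hx ξ (one_lt_norm_subset hξ)
  -- The three averages over the fibre, each with integral zero over `U`.
  obtain ⟨C₁, hC₁⟩ := (hK.prod (isCompact_closedBall (0 : Eu n) 1)).exists_bound_of_continuousOn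
    ((continuousOn_fderiv_apply hU isOpen_univ h.1.1 (e, 0)).mono
      (prod_mono hKU (subset_univ _)))
  obtain ⟨hG₁, hG₁'⟩ := integral_fderiv_fst_eq_zero hU hK hKU isOpen_univ h.1.1
    (fun x hx ξ _ => h0 x hx ξ) e (μ := (volume : Measure (Eu n))) continuous_id
    (V := Metric.closedBall (0 : Eu n) 1) measurableSet_closedBall (mapsTo_univ _ _)
    (g := fun _ => C₁) (integrableOn_const (isCompact_closedBall _ _).measure_lt_top.ne)
    (fun x hx ξ hξ => hC₁ (x, ξ) ⟨hx, hξ⟩)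
  have hG₂ : ∀ k, IntegrableOn (fun x => ∫ θ : Metric.sphere (0 : Eu n) 1,
      fderiv ℝ (τ k) (x, θ.1) (e, 0) ∂(volume : Measure (Eu n)).toSphere) U ∧
      ∫ x in U, ∫ θ : Metric.sphere (0 : Eu n) 1,
        fderiv ℝ (τ k) (x, θ.1) (e, 0) ∂(volume : Measure (Eu n)).toSphere = 0 := fun k => by
    obtain ⟨C₂, hC₂⟩ := (hK.prod (isCompact_sphere (0 : Eu n) 1)).exists_bound_of_continuousOn
      ((continuousOn_fderiv_apply hU isOpen_compl_singleton (h.2.1 k).1 (e, 0)).mono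
        (prod_mono hKU fun θ hθ => ne_zero_of_mem_unit_sphere ⟨θ, hθ⟩))
    have := integral_fderiv_fst_eq_zero hU hK hKU isOpen_compl_singleton (h.2.1 k).1 (hτ0 k) e
      (μ := (volume : Measure (Eu n)).toSphere) continuous_subtype_val
      MeasurableSet.univ (fun θ _ => ne_zero_of_mem_unit_sphere θ)
      (g := fun _ => C₂) (integrable_const _).integrableOn
      (fun x hx θ _ => hC₂ (x, θ.1) ⟨hx, θ.2⟩)
    simpa only [Measure.restrict_univ] using this
  obtain ⟨C₃, hC₃⟩ := h.exists_bound_fderiv_fst hU hχ hK hKU N i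
  have hdecay : Integrable fun ξ : Eu n => (1 + ‖ξ‖) ^ (m.re - N - 1) := by
    have := integrable_one_add_norm (E := Eu n) (μ := volume) (r := -(m.re - N - 1))
      (by rw [finrank_euclideanSpace_fin]; linarith)
    simpa only [neg_neg] using this
  obtain ⟨hG₃, hG₃'⟩ := integral_fderiv_fst_eq_zero hU hK hKU hVo hρV hρ0 e
    (μ := (volume : Measure (Eu n))) continuous_id hVo.measurableSet (mapsTo_id _)
    (hdecay.const_mul C₃).integrableOn (fun x hx ξ hξ => hC₃ x hx ξ hξ)
  simp only [id_eq] at hG₁ hG₁' hG₃ hG₃'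
  set z : ℕ → ℂ := fun k => n + (m - k) with hz
  have hG₂s : IntegrableOn (fun x => ∑ k ∈ Finset.range (N + 1), -1 / z k *
      ∫ θ : Metric.sphere (0 : Eu n) 1, fderiv ℝ (τ k) (x, θ.1) (e, 0)
        ∂(volume : Measure (Eu n)).toSphere) U :=
    integrable_finsetSum _ fun k _ => (hG₂ k).1.const_mul _
  refine ⟨fun x => ((∫ ξ in Metric.closedBall (0 : Eu n) 1, fderiv ℝ σ (x, ξ) (e, 0)) +
    ∑ k ∈ Finset.range (N + 1), -1 / z k * ∫ θ : Metric.sphere (0 : Eu n) 1,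
      fderiv ℝ (τ k) (x, θ.1) (e, 0) ∂(volume : Measure (Eu n)).toSphere) +
    ∫ ξ in V, fderiv ℝ ρ (x, ξ) (e, 0), fun x hx => ?_, (hG₁.add hG₂s).add hG₃, ?_⟩
  · have hcσ : Continuous fun ξ => fderiv ℝ σ (x, ξ) (e, 0) :=
      (continuousOn_fderiv_apply hU isOpen_univ h.1.1 (e, 0)).comp_continuous
        (f := fun ξ => (x, ξ)) (by fun_prop) fun ξ => ⟨hx, mem_univ _⟩
    have hcτ : ∀ k, ContinuousOn (fun ξ => fderiv ℝ (τ k) (x, ξ) (e, 0)) {0}ᶜ := fun k =>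
      (continuousOn_fderiv_apply hU isOpen_compl_singleton (h.2.1 k).1 (e, 0)).comp
        (f := fun ξ => (x, ξ)) (by fun_prop) fun ξ hξ => ⟨hx, hξ⟩
    have hcρ : ContinuousOn (fun ξ => fderiv ℝ ρ (x, ξ) (e, 0)) V :=
      (continuousOn_fderiv_apply hU hVo hρV (e, 0)).comp
        (f := fun ξ => (x, ξ)) (by fun_prop) fun ξ hξ => ⟨hx, hξ⟩
    have hiρ : IntegrableOn (fun ξ => fderiv ℝ ρ (x, ξ) (e, 0)) V := by
      obtain ⟨C, hC⟩ := h.exists_bound_fderiv_fst hU hχ (isCompact_singleton (x := x))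
        (by simpa using hx) N i
      refine (hdecay.const_mul C).integrableOn.mono' (hcρ.aestronglyMeasurable hVo.measurableSet) ?_
      filter_upwards [ae_restrict_mem hVo.measurableSet] with ξ hξ
      exact hC x rfl ξ hξ
    have hshell : ∀ R : ℝ, MeasurableSet {ξ : Eu n | ‖ξ‖ ∈ Ioo 1 R} := fun R =>
      measurable_norm measurableSet_Ioo
    have hshellV : ∀ R : ℝ, {ξ : Eu n | ‖ξ‖ ∈ Ioo 1 R} ⊆ V := fun R ξ hξ => hξ.1
    have hiτ : ∀ k (R : ℝ), IntegrableOn (fun ξ => fderiv ℝ (τ k) (x, ξ) (e, 0))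
        {ξ : Eu n | ‖ξ‖ ∈ Ioo 1 R} := fun k R => by
      have hc : IsCompact (Metric.closedBall (0 : Eu n) R \ Metric.ball 0 1) :=
        (isCompact_closedBall 0 R).diff Metric.isOpen_ball
      refine (((hcτ k).mono fun ξ hξ h0 => ?_).integrableOn_compact hc).mono_set fun ξ hξ => ?_
      · exact hξ.2 (by rw [mem_singleton_iff.1 h0]; simp)
      · exact ⟨by simpa using hξ.2.le, by simpa using hξ.1.le⟩
    have hτpolar : ∀ k (R : ℝ), ∫ ξ in {ξ : Eu n | ‖ξ‖ ∈ Ioo 1 R}, fderiv ℝ (τ k) (x, ξ) (e, 0)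
        = (∫ θ : Metric.sphere (0 : Eu n) 1, fderiv ℝ (τ k) (x, θ.1) (e, 0)
          ∂(volume : Measure (Eu n)).toSphere) * ∫ r in Ioo 1 R, (r : ℂ) ^ (z k - 1) :=
      fun k R => by
        rw [setIntegral_polar hn measurableSet_Ioo
          (fun r hr => lt_trans one_pos hr.1) (hiτ k R), ← integral_const_mul]
        refine setIntegral_congr_fun measurableSet_Ioo fun r hr => ?_
        have hr0 : 0 < r := lt_trans one_pos hr.1
        have hrc : (r : ℂ) ≠ 0 := by exact_mod_cast hr0.ne'
        simp only [(h.2.1 k).fderiv_fst hU hx (ne_zero_of_mem_unit_sphere _) hr0,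
          integral_const_mul]
        have : z k - 1 = ((n - 1 : ℕ) : ℂ) + (m - k) := by
          rw [Nat.cast_sub hn]
          simp only [hz]
          push_cast
          ring
        rw [this, Complex.cpow_add _ _ hrc, Complex.cpow_natCast]
        ring
    have hτfp : ∀ k, HasFinitePart
        (fun R => ∫ ξ in {ξ : Eu n | ‖ξ‖ ∈ Ioo 1 R}, fderiv ℝ (τ k) (x, ξ) (e, 0))
        (-1 / z k * ∫ θ : Metric.sphere (0 : Eu n) 1, fderiv ℝ (τ k) (x, θ.1) (e, 0)
          ∂(volume : Measure (Eu n)).toSphere) := fun k => by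
      rw [mul_comm]
      exact ((hasFinitePart_integral_cpow (z k)).const_mul _).congr'
        (Eventually.of_forall fun R => (hτpolar k R).symm)
    have hρfp : HasFinitePart
        (fun R => ∫ ξ in {ξ : Eu n | ‖ξ‖ ∈ Ioo 1 R}, fderiv ℝ ρ (x, ξ) (e, 0))
        (∫ ξ in V, fderiv ℝ ρ (x, ξ) (e, 0)) := by
      refine hasFinitePart_of_tendsto
        (((aecover_ball (μ := volume.restrict V) (x := (0 : Eu n))
          tendsto_id).integral_tendsto_of_countably_generated hiρ).congr fun R => ?_)
      rw [Measure.restrict_restrict measurableSet_ball]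
      congr 2
      ext ξ
      simp [hV, and_comm]
    refine (((hasFinitePart_const _).add (HasFinitePart.sum (Finset.range (N + 1))
      fun k _ => hτfp k)).add hρfp).congr' ?_
    filter_upwards [eventually_gt_atTop 1] with R hR
    have hball : Metric.ball (0 : Eu n) R
        = Metric.closedBall 0 1 ∪ {ξ : Eu n | ‖ξ‖ ∈ Ioo 1 R} := by
      ext ξ
      simp only [Metric.mem_ball, dist_zero_right, mem_union, Metric.mem_closedBall,
        mem_ofPred_eq, mem_Ioo]
      constructor
      · intro h
        rcases le_or_gt ‖ξ‖ 1 with h1 | h1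
        · exact Or.inl h1
        · exact Or.inr ⟨h1, h⟩
      · rintro (h | h)
        · linarith
        · exact h.2
    have hdisj : Disjoint (Metric.closedBall (0 : Eu n) 1) {ξ : Eu n | ‖ξ‖ ∈ Ioo 1 R} :=
      disjoint_left.2 fun ξ h1 h2 => by
        have h1' : ‖ξ‖ ≤ 1 := by simpa using h1
        exact absurd h2.1 (not_lt.2 h1')
    have hiσ : ∀ r : ℝ, IntegrableOn (fun ξ => fderiv ℝ σ (x, ξ) (e, 0))
        (Metric.closedBall 0 r) := fun r =>
      hcσ.continuousOn.integrableOn_compact (isCompact_closedBall 0 r)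
    rw [hball, setIntegral_union hdisj (hshell R) (hiσ 1)
      ((hiσ R).mono_set fun ξ hξ => by simpa using hξ.2.le), add_assoc]
    congr 1
    rw [← integral_finsetSum _ fun k _ => hiτ k R, ← integral_add
      (integrable_finsetSum _ fun k _ => hiτ k R) (hiρ.mono_set (hshellV R))]
    refine setIntegral_congr_fun (hshell R) fun ξ hξ => ?_
    have hdσ := differentiableAt_of_contDiffOn_prod hU isOpen_univ h.1.1 hx (mem_univ ξ)
    have hdτ : ∀ k ∈ Finset.range (N + 1), DifferentiableAt ℝ (τ k) (x, ξ) := fun k _ =>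
      differentiableAt_of_contDiffOn_prod hU hVo (hτV k) hx (hshellV R hξ)
    simp only [hρ]
    rw [fderiv_fun_sub hdσ (DifferentiableAt.fun_sum hdτ), fderiv_fun_sum hdτ]
    simp
  · have e₁ := integral_add (μ := volume.restrict U) (hG₁.add hG₂s) hG₃
    have e₂ := integral_add (μ := volume.restrict U) hG₁ hG₂s
    simp only [Pi.add_apply] at e₁
    rw [e₁, e₂, hG₁', hG₃', integral_finsetSum _ fun k _ => (hG₂ k).1.const_mul _]
    simp only [integral_const_mul, (hG₂ _).2]
    simp

/-- Cut-off integrals of `ξ`-derivatives: by the divergence theorem only the boundary term of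
degree zero in the radius survives. -/
theorem IsHomogComponent.hasFinitePart_fderiv_snd (hn : 0 < n) (hχ : IsExcision U χ)
    (hU : IsOpen U) (hσ : ContDiffOn ℝ ∞ σ (U ×ˢ univ)) {b : Ph n → ℂ}
    (h : IsHomogComponent U χ (-(n : ℂ) + 1) σ b) {x : Eu n} (hx : x ∈ U) (v : Eu n) :
    HasFinitePart (fun R => ∫ ξ in Metric.ball (0 : Eu n) R, fderiv ℝ σ (x, ξ) (0, v))
      (∫ θ : Metric.sphere (0 : Eu n) 1, b (x, θ.1) * (inner ℝ θ.1 v : ℝ)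
        ∂(volume : Measure (Eu n)).toSphere) := by
  refine (h.hasFinitePart_sphere hχ hx (volume : Measure (Eu n)).toSphere
    (g := fun θ => ((inner ℝ θ.1 v : ℝ) : ℂ)) (by fun_prop)).congr' ?_
  filter_upwards [eventually_gt_atTop 0] with R hR
  have hs : ContDiff ℝ 1 fun ξ => σ (x, ξ) :=
    contDiffOn_univ.1 ((hσ.of_le (by simp)).comp (f := fun ξ => (x, ξ)) (by fun_prop)
      fun ξ _ => ⟨hx, mem_univ _⟩)
  simp only [fderiv_apply_snd (differentiableAt_of_contDiffOn_prod hU isOpen_univ hσ hx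
    (mem_univ _))]
  rw [integral_ball_fderiv hn hs v hR, ← Complex.cpow_natCast, Nat.cast_sub hn]
  congr 2
  push_cast
  ring

theorem IsHomogComponent.integrable_cosphere (hχ : IsExcision U χ) (hU : IsOpen U)
    {K : Set (Eu n)} (hK : IsCompact K) (hKU : K ⊆ U) (h0 : ∀ x ∈ U \ K, ∀ ξ, σ (x, ξ) = 0)
    {s : ℂ} {b : Ph n → ℂ} (h : IsHomogComponent U χ s σ b)
    {g : Metric.sphere (0 : Eu n) 1 → ℂ} (hg : Continuous g) :
    Integrable (fun z : Eu n × Metric.sphere (0 : Eu n) 1 => b (z.1, z.2) * g z.2)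
      (cosphereMeasure U) := by
  have hc : ContinuousOn (fun z : Eu n × Metric.sphere (0 : Eu n) 1 => b (z.1, z.2) * g z.2)
      (U ×ˢ univ) :=
    (h.continuousOn.comp (f := fun z : Eu n × Metric.sphere (0 : Eu n) 1 => (z.1, z.2.1))
      (by fun_prop) fun z hz => ⟨hz.1, ne_zero_of_mem_unit_sphere z.2⟩).mul (by fun_prop)
  obtain ⟨C, hC⟩ := (hK.prod (isCompact_univ (X := Metric.sphere (0 : Eu n) 1)))
    |>.exists_bound_of_continuousOn (hc.mono (prod_mono hKU le_rfl))
  have := integrable_prod_of_compact_support (μ := (volume : Measure (Eu n)).toSphere)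
    MeasurableSet.univ hU hK hc
    (fun x hx θ _ => by simp only [h.eq_zero hχ hx.1 (h0 x hx) θ, zero_mul])
    (g := fun _ => C) (integrable_const _).integrableOn
    (fun x hx θ _ => hC (x, θ) ⟨hx, mem_univ _⟩)
  rwa [Measure.restrict_univ] at this

end

/-! ### Coordinates: exterior derivative and the density on the cosphere bundle -/

section

variable {n k : ℕ}

/-- The `a`-th of the `2n` coordinates `x_1 < ⋯ < x_n < ξ_1 < ⋯ < ξ_n`. -/
noncomputable def coordAt (hk : n + n = k + 1) (a : Fin (k + 1)) : Fin n ⊕ₗ Fin n :=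
  (MultiIndex.full hk).1.orderEmbOfFin (MultiIndex.full hk).2 a

theorem coordAt_strictMono (hk : n + n = k + 1) : StrictMono (coordAt hk) :=
  ((MultiIndex.full hk).1.orderEmbOfFin (MultiIndex.full hk).2).strictMono

theorem exists_coordAt_eq (hk : n + n = k + 1) (c : Fin n ⊕ₗ Fin n) : ∃ a, coordAt hk a = c := by
  have := Finset.range_orderEmbOfFin (MultiIndex.full hk).1 (MultiIndex.full hk).2
  have hc : c ∈ range ((MultiIndex.full hk).1.orderEmbOfFin (MultiIndex.full hk).2) := by
    rw [this]
    exact Finset.mem_coe.2 (Finset.mem_univ c)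
  exact hc

theorem frame_full (hk : n + n = k + 1) (a : Fin (k + 1)) :
    frame (MultiIndex.full hk) a = coordVec n (ofLex (coordAt hk a)) := rfl

/-- The multi-index of all coordinates except the `a`-th. -/
noncomputable def complIndex (hk : n + n = k + 1) (a : Fin (k + 1)) : MultiIndex n k :=
  ⟨Finset.univ.erase (coordAt hk a), by
    rw [Finset.card_erase_of_mem (Finset.mem_univ _)]
    have := (MultiIndex.full hk).2
    change (Finset.univ : Finset (Fin n ⊕ₗ Fin n)).card = k + 1 at this
    omega⟩

theorem frame_complIndex (hk : n + n = k + 1) (a : Fin (k + 1)) :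
    frame (complIndex hk a) = a.removeNth (frame (MultiIndex.full hk)) := by
  have h := Finset.orderEmbOfFin_unique (complIndex hk a).2
    (f := fun i => coordAt hk (a.succAbove i))
    (fun i => Finset.mem_erase.2
      ⟨(coordAt_strictMono hk).injective.ne (Fin.succAbove_ne a i), Finset.mem_univ _⟩)
    ((coordAt_strictMono hk).comp (Fin.strictMono_succAbove a))
  funext i
  simp only [frame, ← h, Fin.removeNth]
  rfl

theorem complIndex_bijective (hk : n + n = k + 1) : Function.Bijective (complIndex hk) := by
  refine ⟨fun a b hab => ?_, fun p => ?_⟩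
  · refine (coordAt_strictMono hk).injective ?_
    by_contra hne
    have h1 : coordAt hk a ∈ (complIndex hk b).1 := Finset.mem_erase.2 ⟨hne, Finset.mem_univ _⟩
    rw [← hab] at h1
    exact (Finset.mem_erase.1 h1).1 rfl
  · have hc : p.1ᶜ.card = 1 := by
      have h1 := p.2
      have h2 := (MultiIndex.full hk).2
      change (Finset.univ : Finset (Fin n ⊕ₗ Fin n)).card = k + 1 at h2
      rw [Finset.card_compl, ← Finset.card_univ]
      omega
    obtain ⟨c, hc⟩ := Finset.card_eq_one.1 hc
    obtain ⟨a, rfl⟩ := exists_coordAt_eq hk c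
    refine ⟨a, Subtype.ext ?_⟩
    change Finset.univ.erase (coordAt hk a) = p.1
    rw [← compl_compl p.1, hc]
    ext
    simp

theorem pairing_coordVec (c d : Fin n ⊕ Fin n) :
    pairing (coordVec n c) (coordVec n d) = if c = d then 1 else 0 := by
  rcases c with i | i <;> rcases d with j | j <;>
    simp [pairing, coordVec, EuclideanSpace.inner_single_left, eq_comm]

theorem pairing_frame_full (hk : n + n = k + 1) (a b : Fin (k + 1)) :
    pairing (frame (MultiIndex.full hk) a) (frame (MultiIndex.full hk) b)
      = if a = b then 1 else 0 := by
  rw [frame_full, frame_full, pairing_coordVec]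
  simp [(coordAt_strictMono hk).injective.eq_iff]

/-- Expansion along the row of the conormal `∑ ξ_j dξ_j`: the only nonzero minor is the one
omitting the missing coordinate. -/
theorem cosphereDensity_complIndex (hk : n + n = k + 1) (a : Fin (k + 1)) (ξ : Eu n) :
    cosphereDensity hk (complIndex hk a) ξ
      = (-1) ^ (a : ℕ) * pairing (0, ξ) (frame (MultiIndex.full hk) a) := by
  unfold cosphereDensity
  rw [Matrix.det_succ_row_zero, Finset.sum_eq_single a]
  · have : (Matrix.of fun a' b : Fin (k + 1) => pairing ((Fin.cons (0, ξ)
        (frame (complIndex hk a)) : Fin (k + 1) → Ph n) a')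
        (frame (MultiIndex.full hk) b)).submatrix Fin.succ a.succAbove = 1 := by
      ext i j
      simp [frame_complIndex, Fin.removeNth, pairing_frame_full, Matrix.one_apply]
    rw [this]
    simp
  · intro b _ hb
    obtain ⟨i, hi⟩ := Fin.exists_succAbove_eq hb
    rw [Matrix.det_eq_zero_of_row_eq_zero i, mul_zero]
    intro j
    simp [frame_complIndex, Fin.removeNth, pairing_frame_full, hi, (Fin.succAbove_ne b j).symm]
  · simp

theorem topCoeff_extDeriv (hk : n + n = k + 1) {β : Form n k} {z : Ph n}
    (hβ : DifferentiableAt ℝ β z) :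
    topCoeff (extDeriv β) z = ∑ a : Fin (k + 1), (-1) ^ (a : ℕ) *
      fderiv ℝ (coeff β (complIndex hk a)) z (frame (MultiIndex.full hk) a) := by
  rw [topCoeff, dif_pos hk, coeff, extDeriv_apply hβ]
  refine Finset.sum_congr rfl fun a _ => ?_
  rw [← frame_complIndex]
  simp only [zsmul_eq_mul]
  push_cast
  rfl

end

/-! ### Decomposition of symbol valued forms -/

section

variable {n k : ℕ} {U : Set (Eu n)} {χ : Ph n → ℝ}

theorem IsSymbol.const_mul {m : ℝ} {σ : Ph n → ℂ} (hU : IsOpen U) (h : IsSymbol U m σ) (c : ℂ) :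
    IsSymbol U m (fun p => c * σ p) := by
  refine ⟨contDiffOn_const.mul h.1, fun K hK hKU r s => ?_⟩
  obtain ⟨C, hC⟩ := h.2 K hK hKU r s
  refine ⟨‖c‖ * C, fun x hx ξ => ?_⟩
  have hs : ContDiffAt ℝ r σ (x, ξ) :=
    (h.1.contDiffAt ((hU.prod isOpen_univ).mem_nhds ⟨hKU hx, mem_univ _⟩)).of_le
      (by exact_mod_cast le_top)
  change ‖iteratedFDeriv ℝ r (c • σ) (x, ξ) _‖ ≤ _
  rw [iteratedFDeriv_const_smul_apply hs, smul_apply, norm_smul,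
    mul_assoc]
  exact mul_le_mul_of_nonneg_left (hC x hx ξ) (norm_nonneg _)

theorem HasClassicalExpansion.const_mul {m : ℂ} {σ : Ph n → ℂ} {τ : ℕ → Ph n → ℂ} (hU : IsOpen U)
    (h : HasClassicalExpansion U χ m σ τ) (c : ℂ) :
    HasClassicalExpansion U χ m (fun p => c * σ p) (fun i p => c * τ i p) := by
  refine ⟨h.1.const_mul hU c, fun i => ⟨contDiffOn_const.mul (h.2.1 i).1,
    fun x hx ξ hξ t ht => ?_⟩, fun N => ?_⟩
  · simp only [(h.2.1 i).2 x hx ξ hξ t ht]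
    ring
  · convert (h.2.2 N).const_mul hU c using 2 with p
    rw [mul_sub, Finset.mul_sum]
    congr 1
    exact Finset.sum_congr rfl fun i _ => by ring

theorem exists_expansions_of_mem_symbolFormsCom (hU : IsOpen U) {β : Form n k}
    (hβ : β ∈ symbolFormsCom U χ k) :
    ContDiffOn ℝ ∞ β (U ×ˢ univ) ∧ ∀ p : MultiIndex n k,
      ∃ (L : ℕ) (m : Fin L → ℂ) (σ : Fin L → Ph n → ℂ) (e : Fin L → ℕ → Ph n → ℂ)
        (K : Set (Eu n)), (∀ l, HasClassicalExpansion U χ (m l) (σ l) (e l)) ∧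
        IsCompact K ∧ K ⊆ U ∧ (∀ l, ∀ x ∈ U \ K, ∀ ξ, σ l (x, ξ) = 0) ∧
        coeff β p = fun z => ∑ l, σ l z := by
  obtain ⟨L, c, α, rfl⟩ := Submodule.mem_span_set'.1 hβ
  choose m hα using fun l => (α l).2
  refine ⟨?_, fun p => ?_⟩
  · have := ContDiffOn.sum (s := Finset.univ) fun l _ => contDiffOn_const (c := c l) |>.smul (hα l).1
    exact this.congr fun z _ => by simp
  · choose e he using fun l => ((hα l).2 p).1
    choose K hK hKU hK0 using fun l => ((hα l).2 p).2
    refine ⟨L, fun l => m l - p.cardJ, fun l z => c l * coeff (α l).1 p z,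
      fun l i z => c l * e l i z, ⋃ l, K l, fun l => (he l).const_mul hU (c l),
      isCompact_iUnion hK, iUnion_subset hKU, fun l x hx ξ => ?_, ?_⟩
    · simp only [hK0 l x ⟨hx.1, fun h => hx.2 (mem_iUnion_of_mem l h)⟩, mul_zero]
    · funext z
      simp [coeff]

/-- The cut-off integral of one partial derivative of a symbol. It vanishes for an `x`-coordinate,
in which case the pairing with the conormal `(0, ξ)` vanishes too. -/
theorem exists_finitePart_fderiv_coordVec (hn : 0 < n) (hU : IsOpen U) (hχ : IsExcision U χ)
    {L : ℕ} {m : Fin L → ℂ} {σ : Fin L → Ph n → ℂ} {e : Fin L → ℕ → Ph n → ℂ}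
    {K : Set (Eu n)} (he : ∀ l, HasClassicalExpansion U χ (m l) (σ l) (e l))
    (hK : IsCompact K) (hKU : K ⊆ U) (h0 : ∀ l, ∀ x ∈ U \ K, ∀ ξ, σ l (x, ξ) = 0)
    {b : Ph n → ℂ} (hb : IsHomogComponent U χ (-(n : ℂ) + 1) (fun z => ∑ l, σ l z) b)
    (c : Fin n ⊕ Fin n) :
    ∃ G : Eu n → ℂ, (∀ x ∈ U, HasFinitePart (fun R => ∫ ξ in Metric.ball (0 : Eu n) R,
      fderiv ℝ (fun z => ∑ l, σ l z) (x, ξ) (coordVec n c)) (G x)) ∧ IntegrableOn G U ∧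
      ∫ x in U, G x = ∫ z : Eu n × Metric.sphere (0 : Eu n) 1,
        b (z.1, z.2) * (pairing (0, z.2.1) (coordVec n c) : ℝ) ∂(cosphereMeasure U) := by
  rcases c with i | j
  · choose G hGf hGi hG0 using fun l =>
      (he l).exists_finitePart_fderiv_fst hn hU hχ hK hKU (h0 l) i
    refine ⟨fun x => ∑ l, G l x, fun x hx => ?_, integrable_finsetSum _ fun l _ => hGi l, ?_⟩
    · refine (HasFinitePart.sum Finset.univ fun l _ => hGf l x hx).congr'
        (Eventually.of_forall fun R => ?_)
      beta_reduce
      rw [← integral_finsetSum]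
      · refine integral_congr_ae (Eventually.of_forall fun ξ => ?_)
        simp only
        rw [fderiv_fun_sum fun l _ =>
          differentiableAt_of_contDiffOn_prod hU isOpen_univ (he l).1.1 hx (mem_univ ξ)]
        simp [coordVec]
      · intro l _
        have hc : Continuous fun ξ => fderiv ℝ (σ l) (x, ξ) (EuclideanSpace.single i 1, 0) :=
          (continuousOn_fderiv_apply hU isOpen_univ (he l).1.1 _).comp_continuous
            (f := fun ξ => (x, ξ)) (by fun_prop) fun ξ => ⟨hx, mem_univ _⟩
        exact (hc.continuousOn.integrableOn_compact (isCompact_closedBall 0 R)).mono_set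
          Metric.ball_subset_closedBall
    · rw [integral_finsetSum _ fun l _ => hGi l]
      simp [hG0, pairing, coordVec]
  · have hint := hb.integrable_cosphere hχ hU hK hKU
      (fun x hx ξ => Finset.sum_eq_zero fun l _ => h0 l x hx ξ)
      (g := fun θ => ((inner ℝ θ.1 (EuclideanSpace.single j 1) : ℝ) : ℂ)) (by fun_prop)
    refine ⟨_, fun x hx => hb.hasFinitePart_fderiv_snd hn hχ hU
      (ContDiffOn.sum fun l _ => (he l).1.1) hx (EuclideanSpace.single j 1),
      hint.integral_prod_left, ?_⟩
    simp only [pairing, coordVec, Sum.elim_inr, inner_zero_left, zero_add]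
    exact (integral_prod _ hint).symm

theorem cutoffExists_and_integral_eq_of_finitePart {σ : Ph n → ℂ} {G : Eu n → ℂ}
    (hU : IsOpen U)
    (hi : ∀ x ∈ U, ∀ R : ℝ, IntegrableOn (fun ξ => σ (x, ξ)) (Metric.ball (0 : Eu n) R))
    (hf : ∀ x ∈ U, HasFinitePart (fun R => ∫ ξ in Metric.ball (0 : Eu n) R, σ (x, ξ)) (G x))
    (hG : IntegrableOn G U) : CutoffExists U σ ∧ cutoffFun U σ = ∫ x in U, G x := by
  have heq : ∀ x ∈ U, fibreCutoff σ x = G x := fun x hx => (hf x hx).finitePart_eq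
  exact ⟨⟨hi, fun x hx => ⟨_, hf x hx⟩,
    hG.congr_fun (fun x hx => (heq x hx).symm) hU.measurableSet⟩,
    setIntegral_congr_fun hU.measurableSet heq⟩

theorem cutoffIntegral_extDeriv (hn : 0 < n) (hU : IsOpen U) (hχ : IsExcision U χ)
    (hk : n + n = k + 1) {β : Form n k} (hβ : β ∈ symbolFormsCom U χ k)
    {b : MultiIndex n k → Ph n → ℂ}
    (hb : ∀ p, IsHomogComponent U χ (-(n : ℂ) + 1) (coeff β p) (b p)) :
    CutoffExists U (topCoeff (extDeriv β)) ∧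
      (∀ p, Integrable (cosphereIntegrand hk p (b p)) (cosphereMeasure U)) ∧
      cutoffIntegral U (extDeriv β) = ∑ p, cosphereIntegral hk U p (b p) := by
  obtain ⟨hβs, hdec⟩ := exists_expansions_of_mem_symbolFormsCom hU hβ
  choose L m σ e K he hK hKU h0 hσ using hdec
  have hcs : ∀ p, ContDiffOn ℝ ∞ (coeff β p) (U ×ˢ univ) := fun p => by
    rw [hσ p]
    exact ContDiffOn.sum fun l _ => (he p l).1.1
  have hfib : ∀ a : Fin (k + 1), ∃ G : Eu n → ℂ, (∀ x ∈ U,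
      HasFinitePart (fun R => ∫ ξ in Metric.ball (0 : Eu n) R,
        fderiv ℝ (coeff β (complIndex hk a)) (x, ξ) (frame (MultiIndex.full hk) a)) (G x)) ∧
      IntegrableOn G U ∧ ∫ x in U, G x = ∫ z : Eu n × Metric.sphere (0 : Eu n) 1,
        b (complIndex hk a) (z.1, z.2) * (pairing (0, z.2.1) (frame (MultiIndex.full hk) a) : ℝ)
          ∂(cosphereMeasure U) := fun a => by
    have hba := hb (complIndex hk a)
    rw [hσ] at hba ⊢
    exact exists_finitePart_fderiv_coordVec hn hU hχ (he _) (hK _) (hKU _) (h0 _) hba _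
  choose G hGf hGi hGe using hfib
  have hcont : ∀ x ∈ U, ∀ a : Fin (k + 1), Continuous fun ξ =>
      fderiv ℝ (coeff β (complIndex hk a)) (x, ξ) (frame (MultiIndex.full hk) a) :=
    fun x hx a => (continuousOn_fderiv_apply hU isOpen_univ (hcs _) _).comp_continuous
      (f := fun ξ => (x, ξ)) (by fun_prop) fun ξ => ⟨hx, mem_univ _⟩
  have hint : ∀ x ∈ U, ∀ (a : Fin (k + 1)) (R : ℝ), IntegrableOn (fun ξ => (-1) ^ (a : ℕ) *
      fderiv ℝ (coeff β (complIndex hk a)) (x, ξ) (frame (MultiIndex.full hk) a))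
      (Metric.ball (0 : Eu n) R) := fun x hx a R =>
    ((continuous_const.mul (hcont x hx a)).continuousOn.integrableOn_compact
      (isCompact_closedBall 0 R)).mono_set Metric.ball_subset_closedBall
  have htop : ∀ x ∈ U, (fun ξ => topCoeff (extDeriv β) (x, ξ)) = fun ξ =>
      ∑ a : Fin (k + 1), (-1) ^ (a : ℕ) *
        fderiv ℝ (coeff β (complIndex hk a)) (x, ξ) (frame (MultiIndex.full hk) a) :=
    fun x hx => funext fun ξ => topCoeff_extDeriv hk
      ((hβs.contDiffAt ((hU.prod isOpen_univ).mem_nhds ⟨hx, mem_univ ξ⟩)).differentiableAt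
        (by simp))
  have hfp : ∀ x ∈ U, HasFinitePart
      (fun R => ∫ ξ in Metric.ball (0 : Eu n) R, topCoeff (extDeriv β) (x, ξ))
      (∑ a : Fin (k + 1), (-1) ^ (a : ℕ) * G a x) := fun x hx => by
    refine (HasFinitePart.sum Finset.univ fun a _ =>
      (hGf a x hx).const_mul ((-1) ^ (a : ℕ))).congr' (Eventually.of_forall fun R => ?_)
    simp only [htop x hx]
    rw [integral_finsetSum _ fun a _ => hint x hx a R]
    simp only [integral_const_mul]
  obtain ⟨hex, heq⟩ := cutoffExists_and_integral_eq_of_finitePart hU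
    (fun x hx R => by
      rw [htop x hx]
      exact integrable_finsetSum _ fun a _ => hint x hx a R)
    hfp (integrable_finsetSum _ fun a _ => (hGi a).const_mul _)
  have hden : ∀ a : Fin (k + 1), cosphereIntegrand hk (complIndex hk a) (b (complIndex hk a))
      = fun z => (-1) ^ (a : ℕ) * (b (complIndex hk a) (z.1, z.2) *
        (pairing (0, z.2.1) (frame (MultiIndex.full hk) a) : ℝ)) := fun a => by
    funext z
    rw [cosphereIntegrand, cosphereDensity_complIndex]
    push_cast
    ring
  refine ⟨hex, fun p => ?_, ?_⟩
  · obtain ⟨a, rfl⟩ := (complIndex_bijective hk).2 p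
    rw [hden]
    refine (((hb (complIndex hk a)).integrable_cosphere hχ hU (hK (complIndex hk a))
      (hKU (complIndex hk a)) (fun x hx ξ => ?_)
      (g := fun θ => ((pairing (0, θ.1) (frame (MultiIndex.full hk) a) : ℝ) : ℂ)) ?_)).const_mul _
    · rw [hσ]
      exact Finset.sum_eq_zero fun l _ => h0 _ l x hx ξ
    · unfold pairing
      fun_prop
  · rw [cutoffIntegral, heq, integral_finsetSum _ fun a _ => (hGi a).const_mul _,
      ← (complIndex_bijective hk).sum_comp]
    refine Finset.sum_congr rfl fun a _ => ?_
    rw [cosphereIntegral, hden, integral_const_mul, integral_const_mul, hGe]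

theorem exists_isHomogComponent_coeff (hU : IsOpen U) {β : Form n k}
    (hβ : β ∈ symbolFormsCom U χ k) (s : ℂ) :
    ∃ b : MultiIndex n k → Ph n → ℂ, ∀ p, IsHomogComponent U χ s (coeff β p) (b p) := by
  choose L m σ e K he _ _ _ hσ using (exists_expansions_of_mem_symbolFormsCom hU hβ).2
  exact ⟨fun p z => ∑ l, ∑ᶠ (i : ℕ) (_ : m p l - (i : ℂ) = s), e p l i z, fun p =>
    ⟨L p, m p, σ p, e p, he p, fun x _ ξ => by rw [hσ], fun x _ ξ _ => rfl⟩⟩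

/-- Components of integral degree vanish for symbols of non-integral order. -/
theorem isHomogComponent_zero_of_nonInteger {m : ℂ} {σ : Ph n → ℂ}
    (hm : ∀ z : ℤ, m ≠ (z : ℂ)) (h : IsClassicalCom U χ m σ) (j : ℤ) :
    IsHomogComponent U χ j σ (fun _ => 0) := by
  obtain ⟨τ, hτ⟩ := h.1
  refine ⟨1, fun _ => m, fun _ => σ, fun _ => τ, fun _ => hτ, by simp, fun x _ ξ _ => ?_⟩
  have : ∀ i : ℕ, m - (i : ℂ) ≠ j := fun i hi => hm (j + i) (by
    push_cast
    linear_combination hi)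
  simp [this]

end

end CutoffStokes

open CutoffStokes
theorem mainTheorem1 (n : ℕ) (hn : 0 < n) (U : Set (Eu n)) (hU : IsOpen U)
    (χ : Ph n → ℝ) (hχ : IsExcision U χ) :
    (∀ β : Form n (2 * n - 1), β ∈ symbolFormsCom U χ (2 * n - 1) →
      CutoffExists U (topCoeff (extDeriv β)) ∧
      (∃ b : MultiIndex n (2 * n - 1) → Ph n → ℂ,
        ∀ p, IsHomogComponent U χ (-(n : ℂ) + 1) (coeff β p) (b p)) ∧
      ∀ b : MultiIndex n (2 * n - 1) → Ph n → ℂ,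
        (∀ p, IsHomogComponent U χ (-(n : ℂ) + 1) (coeff β p) (b p)) →
        (∀ p, Integrable (cosphereIntegrand (by omega) p (b p)) (cosphereMeasure U)) ∧
        cutoffIntegral U (extDeriv β) = ∑ p, cosphereIntegral (by omega) U p (b p)) ∧
    (∀ β : Form n (2 * n - 1), β ∈ nonIntegerFormsCom U χ (2 * n - 1) →
      CutoffExists U (topCoeff (extDeriv β)) ∧ cutoffIntegral U (extDeriv β) = 0) := by
  have hk : n + n = 2 * n - 1 + 1 := by omega
  refine ⟨fun β hβ => ?_, fun β hβ => ?_⟩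
  · obtain ⟨b, hb⟩ := exists_isHomogComponent_coeff hU hβ (-(n : ℂ) + 1)
    exact ⟨(cutoffIntegral_extDeriv hn hU hχ hk hβ hb).1, ⟨b, hb⟩,
      fun b' hb' => (cutoffIntegral_extDeriv hn hU hχ hk hβ hb').2⟩
  · obtain ⟨m, hm, hβm⟩ := hβ
    have hb : ∀ p, IsHomogComponent U χ (-(n : ℂ) + 1) (coeff β p) (fun _ => 0) := fun p => by
      have := isHomogComponent_zero_of_nonInteger (fun z hz => hm (z + p.cardJ) (by
        push_cast
        linear_combination hz)) (hβm.2 p) (-(n : ℤ) + 1)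
      simpa using this
    obtain ⟨hex, -, heq⟩ := cutoffIntegral_extDeriv hn hU hχ hk
      (Submodule.subset_span ⟨m, hβm⟩) (b := fun _ _ => 0) hb
    exact ⟨hex, by rw [heq]; simp [cosphereIntegral, cosphereIntegrand]⟩
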